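/- Let $q=2^r$ with $r\ge 1$, let $\mathrm{tr}(x)=x+x^2+\cdots+x^{2^{r-1}}$ be the trace $\mathbb{F}_q\to\mathbb{F}_2$, and let $\lambda(x)=(-1)^{\mathrm{tr}(x)}$. For $m\ge 1$ and $a\in\mathbb{F}_q^*$ put $$K_m(\lambda;a)=\sum_{\alpha_1,\dots,\alpha_m\in\mathbb{F}_q^*}\lambda(\alpha_1+\cdots+\alpha_m+a\alpha_1^{-1}\cdots\alpha_m^{-1}),\qquad K(\lambda;a)=K_1(\lambda;a).$$ Let $P=P(2n,q)$ be the maximal parabolic subgroup of the symplectic group $Sp(2n,q)$ consisting of the matrices $$\begin{bmatrix}A&0\\0&{}^tA^{-1}\end{bmatrix}\begin{bmatrix}1_n&B\\0&1_n\end{bmatrix},\qquad A\in GL(n,q),\ {}^tB=B,$$ and for $0\le s\le n$ let $$\sigma_s=\begin{bmatrix}0&0&1_s&0\\0&1_{n-s}&0&0\\1_s&0&0&0\\0&0&0&1_{n-s}\end{bmatrix}.$$ Put $DC^-(n,q)=P\sigma_{n-1}P$ for odd $n\ge1$ and $DC^+(n,q)=P\sigma_{n-2}P$ for even $n\ge 2$,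 and let $N^{\mp}(n,q)=|DC^{\mp}(n,q)|$. With $\left[{n\atop s}\right]_q=\prod_{j=0}^{s-1}(q^{n-j}-1)/(q^{s-j}-1)$, put $$A^-(n,q)=q^{\frac14(5n^2-1)}\left[{n\atop 1}\right]_q\prod_{j=1}^{(n-1)/2}(q^{2j-1}-1),\qquad B^-(n,q)=q^{\frac14(n-1)^2}(q^n-1)\prod_{j=1}^{(n-1)/2}(q^{2j}-1),$$ $$A^+(n,q)=q^{\frac14(5n^2-2n)}\left[{n\atop 2}\right]_q\prod_{j=1}^{(n-2)/2}(q^{2j-1}-1),\qquad B^+(n,q)=q^{\frac14(n-2)^2}(q^n-1)(q^{n-1}-1)\prod_{j=1}^{(n-2)/2}(q^{2j}-1).$$ For any ordering $g_1,\dots,g_N$ of the elements of $DC^{\mp}(n,q)$, where $N=N^{\mp}(n,q)$, let $C(DC^{\mp}(n,q))=\{u\in\mathbb{F}_2^N : \sum_j u_j\,\mathrm{Tr}\,g_j=0\}$ ($\mathrm{Tr}$ is the matrix trace) and, for $a\in\mathbb{F}_q^*$, let $c^{\mp}(a)=(\mathrm{tr}(a\,\mathrm{Tr}\,g_1),\dots,\mathrm{tr}(a\,\mathrm{Tr}\,g_N))$.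 Then $c^{\mp}(a)$ lies in the dual code $C(DC^{\mp}(n,q))^\perp$, and its Hamming weight $w$ is as follows. (a) For every odd $n\ge 1$ and every $a\in\mathbb{F}_q^*$, $$w(c^-(a))=\tfrac12A^-(n,q)\bigl(B^-(n,q)-K(\lambda;a)\bigr).$$ (b) For every even $n\ge 2$ and every $a\in\mathbb{F}_q^*$, $$w(c^+(a))=\tfrac12A^+(n,q)\bigl(B^+(n,q)-q^2+q-K(\lambda;a)^2\bigr)=\tfrac12A^+(n,q)\bigl(B^+(n,q)-q^2-K_2(\lambda;a)\bigr).$$ -/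

import Mathlib

open Matrix

noncomputable section

namespace SpCodes

section Characters

variable {F : Type*} [Field F] [Fintype F]

/-- The absolute trace `tr : F → 𝔽₂`, `tr x = x + x² + ⋯ + x^(2^(r-1))` where `|F| = 2^r`. -/
def tr [Algebra (ZMod 2) F] (x : F) : ZMod 2 := Algebra.trace (ZMod 2) F x

/-- `tr` is given by the usual sum of conjugates. -/
theorem algebraMap_tr [Algebra (ZMod 2) F] (x : F) :
    algebraMap (ZMod 2) F (tr x) =
      ∑ i ∈ Finset.range (Module.finrank (ZMod 2) F), x ^ 2 ^ i := by
  simpa [tr, Nat.card_eq_fintype_card, ZMod.card] using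
    FiniteField.algebraMap_trace_eq_sum_pow (ZMod 2) F x

/-- The canonical additive character `λ(x) = (-1)^(tr x)` of `F`. -/
def canonicalChar (F : Type*) [Field F] [Fintype F] [Algebra (ZMod 2) F] : AddChar F ℂ where
  toFun x := (-1) ^ (tr x).val
  map_zero_eq_one' := by simp [tr]
  map_add_eq_mul' x y := by
    have h : ∀ u v : ZMod 2, (-1 : ℂ) ^ (u + v).val = (-1) ^ u.val * (-1) ^ v.val := by
      intro u v
      rw [ZMod.val_add, ← pow_add]
      exact (neg_one_pow_eq_pow_mod_two _).symm
    simp only [tr, map_add]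
    exact h _ _

/-- The `m`-dimensional Kloosterman sum
`K_m(ψ; a) = ∑ ψ(α₁ + ⋯ + α_m + a α₁⁻¹ ⋯ α_m⁻¹)` over `α₁, …, α_m ∈ F^*`. -/
def kloosterman [DecidableEq F] (m : ℕ) (ψ : AddChar F ℂ) (a : F) : ℂ :=
  ∑ α : Fin m → Fˣ, ψ (∑ i, (α i : F) + a * ∏ i, (α i : F)⁻¹)

end Characters

section Constants

/-- The `q`-binomial coefficient `∏_{j=0}^{r-1} (q^(n-j) - 1) / (q^(r-j) - 1)`. -/
def qBinom (n r q : ℕ) : ℂ :=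
  ∏ j ∈ Finset.range r, ((q : ℂ) ^ (n - j) - 1) / ((q : ℂ) ^ (r - j) - 1)

/-- `A⁻(n, q)`, for odd `n` (the division in the exponent is then exact). -/
def Aminus (n q : ℕ) : ℂ :=
  (q : ℂ) ^ ((5 * n ^ 2 - 1) / 4) * qBinom n 1 q *
    ∏ j ∈ Finset.Icc 1 ((n - 1) / 2), ((q : ℂ) ^ (2 * j - 1) - 1)

/-- `B⁻(n, q)`, for odd `n`. -/
def Bminus (n q : ℕ) : ℂ :=
  (q : ℂ) ^ ((n - 1) ^ 2 / 4) * ((q : ℂ) ^ n - 1) *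
    ∏ j ∈ Finset.Icc 1 ((n - 1) / 2), ((q : ℂ) ^ (2 * j) - 1)

/-- `A⁺(n, q)`, for even `n ≥ 2` (the division in the exponent is then exact). -/
def Aplus (n q : ℕ) : ℂ :=
  (q : ℂ) ^ ((5 * n ^ 2 - 2 * n) / 4) * qBinom n 2 q *
    ∏ j ∈ Finset.Icc 1 ((n - 2) / 2), ((q : ℂ) ^ (2 * j - 1) - 1)

/-- `B⁺(n, q)`, for even `n ≥ 2`. -/
def Bplus (n q : ℕ) : ℂ :=
  (q : ℂ) ^ ((n - 2) ^ 2 / 4) * ((q : ℂ) ^ n - 1) * ((q : ℂ) ^ (n - 1) - 1) *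
    ∏ j ∈ Finset.Icc 1 ((n - 2) / 2), ((q : ℂ) ^ (2 * j) - 1)

end Constants

section DoubleCosets

variable (F : Type*) [Field F]

/-- The maximal parabolic subgroup `P(2n, q)` of the symplectic group, as a set of `2n × 2n`
matrices: the products `[A, 0; 0, ᵗA⁻¹] [1, B; 0, 1]` with `A` invertible and `B` symmetric. -/
def parabolic (n : ℕ) : Set (Matrix (Fin n ⊕ Fin n) (Fin n ⊕ Fin n) F) :=
  {w | ∃ (A : GL (Fin n) F) (B : Matrix (Fin n) (Fin n) F), Bᵀ = B ∧
    w = fromBlocks (A : Matrix (Fin n) (Fin n) F) 0 0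
          ((A⁻¹ : GL (Fin n) F) : Matrix (Fin n) (Fin n) F)ᵀ *
        fromBlocks 1 B 0 1}

/-- The diagonal matrix with `r` ones followed by `n - r` zeros. -/
def firstOnes (n r : ℕ) : Matrix (Fin n) (Fin n) F :=
  Matrix.diagonal fun i => if (i : ℕ) < r then 1 else 0

/-- The matrix `σ_r = [0, 0, 1_r, 0; 0, 1_{n-r}, 0, 0; 1_r, 0, 0, 0; 0, 0, 0, 1_{n-r}]`. -/
def sigma (n r : ℕ) : Matrix (Fin n ⊕ Fin n) (Fin n ⊕ Fin n) F :=
  fromBlocks (1 - firstOnes F n r) (firstOnes F n r)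
    (firstOnes F n r) (1 - firstOnes F n r)

/-- The double coset `P σ_r P`. -/
def PsigmaP (n r : ℕ) : Set (Matrix (Fin n ⊕ Fin n) (Fin n ⊕ Fin n) F) :=
  DoubleCoset.doubleCoset (sigma F n r) (parabolic F n) (parabolic F n)

/-- In characteristic two, `P σ_r P` is contained in the symplectic group. -/
theorem PsigmaP_subset_symplecticGroup [CharP F 2] (n r : ℕ) :
    PsigmaP F n r ⊆ (Matrix.symplecticGroup (Fin n) F :
      Set (Matrix (Fin n ⊕ Fin n) (Fin n ⊕ Fin n) F)) := by
  have hP : ∀ w ∈ parabolic F n, w ∈ Matrix.symplecticGroup (Fin n) F := by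
    rintro w ⟨A, B, hB, rfl⟩
    refine mul_mem ?_ ?_
    · rw [SymplecticGroup.mem_iff]
      have h1 : (A : Matrix (Fin n) (Fin n) F) *
          ((A⁻¹ : GL (Fin n) F) : Matrix (Fin n) (Fin n) F) = 1 := A.mul_inv
      have h2 : ((A⁻¹ : GL (Fin n) F) : Matrix (Fin n) (Fin n) F)ᵀ *
          (A : Matrix (Fin n) (Fin n) F)ᵀ = 1 := by
        rw [← transpose_mul, h1, transpose_one]
      simp only [J, fromBlocks_transpose, fromBlocks_multiply, transpose_transpose]
      simp only [transpose_zero, mul_zero, zero_mul, mul_one, mul_neg, neg_mul, add_zero,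
        zero_add, neg_zero, h1, h2]
    · rw [SymplecticGroup.mem_iff]
      simp [J, fromBlocks_transpose, fromBlocks_multiply, hB]
  have hE : firstOnes F n r * firstOnes F n r = firstOnes F n r := by
    simp [firstOnes, diagonal_mul_diagonal]
  have hEt : (firstOnes F n r)ᵀ = firstOnes F n r := by simp [firstOnes]
  have hneg : ∀ M : Matrix (Fin n) (Fin n) F, -M = M := by
    intro M; ext i j; simp [CharTwo.neg_eq]
  have hadd : ∀ M : Matrix (Fin n) (Fin n) F, M + M = 0 := by
    intro M; ext i j; simp [CharTwo.add_self_eq_zero]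
  have hS : sigma F n r ∈ Matrix.symplecticGroup (Fin n) F := by
    rw [SymplecticGroup.mem_iff]
    simp only [sigma, J, fromBlocks_transpose, fromBlocks_multiply, transpose_sub,
      transpose_one, hEt, hneg]
    simp [mul_sub, sub_mul, hE]
  intro w hw
  obtain ⟨x, hx, y, hy, rfl⟩ := DoubleCoset.mem_doubleCoset.1 hw
  exact mul_mem (mul_mem (hP x hx) hS) (hP y hy)

/-- `DC⁻(n, q) = P σ_{n-1} P`. -/
def DCminus (n : ℕ) : Set (Matrix (Fin n ⊕ Fin n) (Fin n ⊕ Fin n) F) := PsigmaP F n (n - 1)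

/-- `DC⁺(n, q) = P σ_{n-2} P`. -/
def DCplus (n : ℕ) : Set (Matrix (Fin n ⊕ Fin n) (Fin n ⊕ Fin n) F) := PsigmaP F n (n - 2)

end DoubleCosets

section Codes

variable {F : Type*} [Field F] [Fintype F] [Algebra (ZMod 2) F]

/-- The binary code `{u ∈ 𝔽₂^N | u · v = 0}` attached to a vector `v ∈ F^N`. -/
def code {N : ℕ} (v : Fin N → F) : Submodule (ZMod 2) (Fin N → ZMod 2) where
  carrier := {u | ∑ j, algebraMap (ZMod 2) F (u j) * v j = 0}
  zero_mem' := by simp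
  add_mem' {u u'} hu hu' := by
    simp only [Set.mem_ofPred_eq] at hu hu' ⊢
    simp [add_mul, Finset.sum_add_distrib, hu, hu']
  smul_mem' c u hu := by
    simp only [Set.mem_ofPred_eq] at hu ⊢
    simp [mul_assoc, ← Finset.mul_sum, hu]

/-- The dual of a binary code with respect to the usual inner product. -/
def dualCode {N : ℕ} (C : Submodule (ZMod 2) (Fin N → ZMod 2)) :
    Submodule (ZMod 2) (Fin N → ZMod 2) where
  carrier := {c | ∀ u ∈ C, u ⬝ᵥ c = 0}
  zero_mem' := by simp
  add_mem' {c c'} hc hc' u hu := by rw [dotProduct_add, hc u hu, hc' u hu, add_zero]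
  smul_mem' k c hc u hu := by rw [dotProduct_smul, hc u hu, smul_zero]

/-- For an ordering `g₁, …, g_N` of a set `S` of square matrices, the vector
`(Tr g₁, …, Tr g_N)`. -/
def traceVector {ι : Type*} [Fintype ι] {S : Set (Matrix ι ι F)} {N : ℕ} (g : Fin N ≃ S) :
    Fin N → F :=
  fun j => (g j : Matrix ι ι F).trace

/-- The word `c(a) = (tr(a Tr g₁), …, tr(a Tr g_N))`. -/
def codeword {ι : Type*} [Fintype ι] {S : Set (Matrix ι ι F)} {N : ℕ} (g : Fin N ≃ S) (a : F) :
    Fin N → ZMod 2 :=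
  fun j => tr (a * traceVector g j)

end Codes

end SpCodes

end

noncomputable section

namespace SpCodes

/-! Let D = PσP with σ = σ_r and k = n - r. Since 2·[c ≠ 0] = 1 - (-1)^c on 𝔽₂, twice the weight of
c(a) is |D| minus the sum of λ(a Tr g) over D, so everything rests on one exponential sum. The trace
is a class function, so the map (x, y) ↦ xσy from P × P onto D, whose fibres all have the order of P
∩ σPσ⁻¹, reduces that sum to one of λ(a Tr wσ) over w in P (`card_mul_sum_doubleCoset`). The same
identity for the constant 1 gives |D|.

Write w through (A, B) and let E = `firstOnes`. Then Tr wσ = Tr(EAB) + Tr(A(1-E)) + Tr(A⁻¹(1-E)).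
Orthogonality over symmetric B leaves only those A for which EA is alternating
(`sum_symmetric_canonicalChar`). This forces A to be block lower triangular, with a nonsingular
alternating r × r block X, a free block Z and an arbitrary W in GL(k). Hence the sum over P is a
product of |Sym_n|, the number of such X, q^(kr), and the sum of λ(a(Tr W + Tr W⁻¹)) over GL(k)
(`sum_isAlternating_firstOnes_mul`, `sum_parabolic`).

Both cases have r even. For k = 1 the GL sum is K(a²) = K(a), by Frobenius; for k = 2 it is q(K² +
q² - q) (`glKloosterman_two`). Nonsingular alternating matrices are counted by bordering
(`altCount_two_mul`). Inserting the group orders gives the closed forms, and Carlitz's identity K₂ =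
K² - q gives the second expression in the even case. Membership in the dual code is just
𝔽₂-linearity of tr. -/

theorem sum_eq_add_sum_units {F : Type*} [Field F] [Fintype F] [DecidableEq F] (f : F → ℂ) : ∑ x : F, f x = f 0 + ∑ x : Fˣ, f x := by
  rw [← Finset.add_sum_erase Finset.univ f (Finset.mem_univ 0)]
  congr 1
  symm
  refine Finset.sum_bij (fun u _ => (u : F)) (fun u _ => by simp) (fun u _ v _ h => Units.ext h)
    (fun x hx => ?_) (fun _ _ => rfl)
  exact ⟨Units.mk0 x (by simpa using hx), by simp⟩

/-! ### The canonical character and Kloosterman sums in characteristic two. -/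

section CharacterSums
variable {F : Type*} [Field F] [Fintype F] [Algebra (ZMod 2) F]

theorem charP_two_of_algebra (F : Type*) [Field F] [Algebra (ZMod 2) F] : CharP F 2 :=
  (Algebra.charP_iff (ZMod 2) F 2).1 inferInstance

/-- Frobenius is an automorphism over the prime field, and the trace is invariant under
automorphisms. Every Kloosterman identity below that is special to characteristic two uses this. -/
theorem tr_sq (x : F) : tr (x ^ 2) = tr x := by
  have h := Algebra.trace_eq_of_algEquiv (FiniteField.frobeniusAlgEquivOfAlgebraic (ZMod 2) F) x
  simpa [tr] using h

theorem canonicalChar_sq (x : F) : canonicalChar F (x ^ 2) = canonicalChar F x := by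
  change (-1 : ℂ) ^ (tr (x ^ 2)).val = (-1) ^ (tr x).val
  rw [tr_sq]

theorem canonicalChar_ne_zero : canonicalChar F ≠ 0 := by
  obtain ⟨x, hx⟩ := Algebra.trace_surjective (ZMod 2) F 1
  intro h
  have h1 : canonicalChar F x = 1 := by rw [h]; rfl
  have h2 : canonicalChar F x = (-1) ^ (tr x).val := rfl
  rw [h2, tr, hx] at h1
  norm_num [ZMod.val_one] at h1

theorem canonicalChar_eq_of_sq {x y : F} (h : y = x ^ 2) :
    canonicalChar F x = canonicalChar F y := by
  rw [h, canonicalChar_sq]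

/-- Squaring, as a permutation of the units. -/
def unitsSq (F : Type*) [Field F] [Fintype F] [Algebra (ZMod 2) F] : Fˣ ≃ Fˣ :=
  (Units.mapEquiv (FiniteField.frobeniusAlgEquivOfAlgebraic (ZMod 2) F).toMulEquiv).toEquiv

theorem unitsSq_val (x : Fˣ) : ((unitsSq F x : Fˣ) : F) = (x : F) ^ 2 := by
  simp [unitsSq]

variable [DecidableEq F]

theorem sum_canonicalChar_mul (c : F) :
    ∑ x : F, canonicalChar F (c * x) = if c = 0 then (Fintype.card F : ℂ) else 0 := by
  split_ifs with hc
  · simp [hc]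
  · rw [← AddChar.sum_eq_zero_iff_ne_zero.2 (canonicalChar_ne_zero (F := F))]
    exact Fintype.sum_equiv (Equiv.mulLeft₀ c hc) _ _ fun x => rfl

theorem sum_units_canonicalChar_mul (c : F) :
    ∑ x : Fˣ, canonicalChar F (c * x) = if c = 0 then (Fintype.card F : ℂ) - 1 else -1 := by
  have h := sum_canonicalChar_mul c
  rw [sum_eq_add_sum_units] at h
  simp only [mul_zero, AddChar.map_zero_eq_one] at h
  split_ifs at h ⊢ <;> linear_combination h

theorem kloosterman_one (a : F) :
    kloosterman 1 (canonicalChar F) a = ∑ x : Fˣ, canonicalChar F (x + a * (x : F)⁻¹) := by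
  unfold kloosterman
  refine Fintype.sum_equiv (Equiv.funUnique (Fin 1) Fˣ) _ _ fun α => ?_
  simp

theorem kloosterman_two (a : F) :
    kloosterman 2 (canonicalChar F) a = ∑ x : Fˣ, ∑ y : Fˣ, canonicalChar F (x + y + a * ((x : F)⁻¹ * (y : F)⁻¹)) := by
  unfold kloosterman
  rw [← Fintype.sum_prod_type' (f := fun x y : Fˣ => canonicalChar F (x + y + a * ((x : F)⁻¹ * (y : F)⁻¹)))]
  refine Fintype.sum_equiv (finTwoArrowEquiv Fˣ) _ _ fun α => ?_
  simp [Fin.sum_univ_two, Fin.prod_univ_two, mul_comm]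

/-- Substitute bx for x. Together with `kloosterman_one_sq` this evaluates the sum as K(b). -/
theorem kloosterman_one_scaled (b : Fˣ) :
    ∑ x : Fˣ, canonicalChar F (b * (x + (x : F)⁻¹)) = kloosterman 1 (canonicalChar F) ((b : F) ^ 2) := by
  rw [kloosterman_one]
  refine Fintype.sum_equiv (Equiv.mulLeft b) _ _ fun x => ?_
  congr 1
  simp only [Equiv.coe_mulLeft, Units.val_mul]
  field_simp

theorem kloosterman_one_sq (a : F) : kloosterman 1 (canonicalChar F) (a ^ 2) = kloosterman 1 (canonicalChar F) a := by
  have := charP_two_of_algebra F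
  rw [kloosterman_one, kloosterman_one]
  symm
  refine Fintype.sum_equiv (unitsSq F) _ _ fun x => canonicalChar_eq_of_sq ?_
  rw [unitsSq_val, CharTwo.add_sq]
  field_simp

/-- Carlitz's identity `K₂ = K² - q` in characteristic two. -/
theorem kloosterman_two_eq (a : F) (ha : a ≠ 0) :
    kloosterman 2 (canonicalChar F) a = kloosterman 1 (canonicalChar F) a ^ 2 - Fintype.card F := by
  have := charP_two_of_algebra F
  -- The second summation variable is written as tx, with x the first one.
  have h1 : kloosterman 1 (canonicalChar F) a ^ 2 =
      ∑ t : Fˣ, ∑ x : Fˣ, canonicalChar F (x * (1 + t) + a * (1 + t) * (t : F)⁻¹ * (x : F)⁻¹) := by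
    rw [sq, kloosterman_one, Finset.sum_mul_sum]
    rw [Finset.sum_comm (γ := Fˣ) (f := fun t x : Fˣ => canonicalChar F _)]
    refine Finset.sum_congr rfl fun x _ => ?_
    refine (Fintype.sum_equiv (Equiv.mulRight x) _ _ fun t => ?_).symm
    rw [← AddChar.map_add_eq_mul]
    congr 1
    simp only [Equiv.coe_mulRight, Units.val_mul]
    field_simp
    ring
  -- For t ≠ 1, rescale x by 1 + t and use (1 + t)²/t = t + t⁻¹ in characteristic two. For t = 1 the
  -- left side is q - 1 and the sum on the right is -1, which leaves the correction q.
  have h2 : ∀ t : Fˣ, ∑ x : Fˣ, canonicalChar F (x * (1 + t) + a * (1 + t) * (t : F)⁻¹ * (x : F)⁻¹) =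
      ∑ x : Fˣ, canonicalChar F (x + a * (t + (t : F)⁻¹) * (x : F)⁻¹) +
        if t = 1 then (Fintype.card F : ℂ) else 0 := by
    intro t
    split_ifs with ht
    · subst ht
      have := sum_units_canonicalChar_mul (1 : F)
      simp only [one_mul, one_ne_zero, if_false] at this
      have hq : ((Fintype.card F - 1 : ℕ) : ℂ) = Fintype.card F - 1 := by
        rw [Nat.cast_sub Fintype.card_pos, Nat.cast_one]
      simp [CharTwo.add_self_eq_zero, this, Fintype.card_units, hq]
      ring
    · rw [add_zero]
      have h0 : (1 + t : F) ≠ 0 := by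
        intro h
        rw [CharTwo.add_eq_zero] at h
        exact ht (Units.ext h.symm)
      refine Fintype.sum_equiv (Equiv.mulRight (Units.mk0 _ h0)) _ _ fun x => ?_
      congr 1
      simp only [Equiv.coe_mulRight, Units.val_mul, Units.val_mk0]
      have h2 : (2 : F) = 0 := CharTwo.two_eq_zero
      field_simp
      linear_combination (a * t) * h2
  rw [h1, Finset.sum_congr rfl fun t _ => h2 t, Finset.sum_add_distrib]
  simp only [Finset.sum_ite_eq', Finset.mem_univ, if_true, add_sub_cancel_right]
  rw [Finset.sum_comm]
  -- The substitution is y = at/x, so that a/(tx) becomes a²/(x²y).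
  have h3 : ∀ x : Fˣ, ∑ t : Fˣ, canonicalChar F (x + a * (t + (t : F)⁻¹) * (x : F)⁻¹) =
      ∑ y : Fˣ, canonicalChar F (x + y + a ^ 2 * ((x : F)⁻¹ ^ 2 * (y : F)⁻¹)) := by
    intro x
    refine Fintype.sum_equiv (Equiv.mulLeft (Units.mk0 a ha * x⁻¹)) _ _ fun t => ?_
    congr 1
    simp only [Equiv.coe_mulLeft, Units.val_mul, Units.val_mk0, Units.val_inv_eq_inv_val]
    field_simp
    ring
  rw [Finset.sum_congr rfl fun x _ => h3 x, kloosterman_two]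
  -- Both sides meet at the sum with a²/(xy): one by squaring the whole argument and reindexing x
  -- and y, the other by reindexing x alone and using λ(x²) = λ(x).
  calc _ = ∑ x : Fˣ, ∑ y : Fˣ,
      canonicalChar F (x + y + a ^ 2 * ((x : F)⁻¹ * (y : F)⁻¹)) := by
        refine Fintype.sum_equiv (unitsSq F) _ _ fun x => ?_
        refine Fintype.sum_equiv (unitsSq F) _ _ fun y => canonicalChar_eq_of_sq ?_
        simp only [unitsSq_val, CharTwo.add_sq]
        ring
    _ = _ := by
        refine (Fintype.sum_equiv (unitsSq F) _ _ fun x => Fintype.sum_congr _ _ fun y => ?_).symm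
        rw [AddChar.map_add_eq_mul, AddChar.map_add_eq_mul, AddChar.map_add_eq_mul,
          AddChar.map_add_eq_mul, unitsSq_val, canonicalChar_sq, inv_pow]

end CharacterSums

/-! ### Kloosterman sums over GL(1) and GL(2). -/

section GLSums

/-- The adjugate of a 2 × 2 matrix has the same trace as the matrix. -/
theorem trace_units_inv_fin_two {F : Type*} [Field F] (W : GL (Fin 2) F) :
    ((W⁻¹ : GL (Fin 2) F) : Matrix (Fin 2) (Fin 2) F).trace =
      (W : Matrix (Fin 2) (Fin 2) F).trace * (W : Matrix (Fin 2) (Fin 2) F).det⁻¹ := by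
  rw [coe_units_inv, inv_def, adjugate_fin_two, Ring.inverse_eq_inv']
  simp [trace_fin_two]
  ring

variable {F : Type*} [Field F] [Fintype F] [Algebra (ZMod 2) F] [DecidableEq F]

/-- The Kloosterman sum for `GL(k, q)` with equal parameters. -/
def glKloosterman (k : ℕ) (a : F) : ℂ :=
  ∑ W : GL (Fin k) F, canonicalChar F (a * ((W : Matrix (Fin k) (Fin k) F).trace +
    ((W⁻¹ : GL (Fin k) F) : Matrix (Fin k) (Fin k) F).trace))

theorem glKloosterman_one (a : F) (ha : a ≠ 0) :
    glKloosterman 1 a = kloosterman 1 (canonicalChar F) a := by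
  rw [← kloosterman_one_sq, ← Units.val_mk0 ha, ← kloosterman_one_scaled]
  unfold glKloosterman
  refine Fintype.sum_equiv
    (Units.mapEquiv (uniqueRingEquiv (m := Fin 1) (A := F)).toMulEquiv).toEquiv _ _ fun W => ?_
  simp [trace]
  rfl

/-- Split by the upper right entry. Lower triangular matrices give qK², one K for each diagonal
entry and q for the free corner. The others give (q - 1)q², since only determinant 1 survives the
sum over the diagonal. -/
theorem glKloosterman_two (a : F) (ha : a ≠ 0) :
    glKloosterman 2 a = Fintype.card F * (kloosterman 1 (canonicalChar F) a ^ 2 +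
      (Fintype.card F : ℂ) ^ 2 - Fintype.card F) := by
  have := charP_two_of_algebra F
  have hdet : ∀ W : GL (Fin 2) F, (W : Matrix (Fin 2) (Fin 2) F).det ≠ 0 :=
    fun W => (W.isUnit.map detMonoidHom).ne_zero
  unfold glKloosterman
  simp only [trace_units_inv_fin_two]
  rw [← Finset.sum_filter_add_sum_filter_not Finset.univ (fun W : GL (Fin 2) F => W 0 1 = 0)]
  have h1 : ∑ W : GL (Fin 2) F with W 0 1 = 0, canonicalChar F
        (a * ((W : Matrix (Fin 2) (Fin 2) F).trace + (W : Matrix (Fin 2) (Fin 2) F).trace *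
          (W : Matrix (Fin 2) (Fin 2) F).det⁻¹)) =
      ∑ p : Fˣ × Fˣ × F, canonicalChar F (a * (p.1 + (p.1 : F)⁻¹)) *
        canonicalChar F (a * (p.2.1 + (p.2.1 : F)⁻¹)) := by
    symm
    refine Finset.sum_bij (fun p _ => GeneralLinearGroup.mkOfDetNeZero
      !![(p.1 : F), 0; p.2.2, (p.2.1 : F)] (by simp [det_fin_two])) ?_ ?_ ?_ ?_
    · intro p _
      simp [GeneralLinearGroup.mkOfDetNeZero]
    · rintro ⟨x, w, z⟩ _ ⟨x', w', z'⟩ _ h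
      have h := congrArg Units.val h
      simp [GeneralLinearGroup.mkOfDetNeZero] at h
      ext <;> simp [h]
    · intro W hW
      simp only [Finset.mem_filter, Finset.mem_univ, true_and] at hW
      have hd := hdet W
      rw [det_fin_two, hW, zero_mul, sub_zero] at hd
      refine ⟨⟨Units.mk0 _ (left_ne_zero_of_mul hd), Units.mk0 _ (right_ne_zero_of_mul hd), W 1 0⟩,
        Finset.mem_univ _, ?_⟩
      ext i j
      fin_cases i <;> fin_cases j <;> simp [GeneralLinearGroup.mkOfDetNeZero, hW]
    · intro p _
      rw [← AddChar.map_add_eq_mul]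
      congr 1
      simp [GeneralLinearGroup.mkOfDetNeZero, trace_fin_two, det_fin_two]
      have h2 : (2 : F) = 0 := CharTwo.two_eq_zero
      field_simp
      ring
  -- Coordinates here are the upper right entry, the determinant and the two diagonal entries; the
  -- lower left entry is then determined. The argument of λ becomes linear in the diagonal entries.
  have h2 : ∑ W : GL (Fin 2) F with ¬ W 0 1 = 0, canonicalChar F
        (a * ((W : Matrix (Fin 2) (Fin 2) F).trace + (W : Matrix (Fin 2) (Fin 2) F).trace *
          (W : Matrix (Fin 2) (Fin 2) F).det⁻¹)) =
      ∑ p : Fˣ × Fˣ × F × F, canonicalChar F ((a * (1 + (p.2.1 : F)⁻¹)) * p.2.2.1) *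
        canonicalChar F ((a * (1 + (p.2.1 : F)⁻¹)) * p.2.2.2) := by
    have hm : ∀ p : Fˣ × Fˣ × F × F, (!![p.2.2.1, (p.1 : F);
        (p.2.2.1 * p.2.2.2 - p.2.1) * (p.1 : F)⁻¹, p.2.2.2]).det = p.2.1 := by
      intro p
      rw [det_fin_two_of]
      field_simp
      ring
    symm
    refine Finset.sum_bij (fun p _ => GeneralLinearGroup.mkOfDetNeZero
      !![p.2.2.1, (p.1 : F); (p.2.2.1 * p.2.2.2 - p.2.1) * (p.1 : F)⁻¹, p.2.2.2]
        (by rw [hm]; exact p.2.1.ne_zero)) ?_ ?_ ?_ ?_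
    · intro p _
      simp [GeneralLinearGroup.mkOfDetNeZero]
    · rintro ⟨y, d, x, w⟩ _ ⟨y', d', x', w'⟩ _ h
      have h := congrArg Units.val h
      simp [GeneralLinearGroup.mkOfDetNeZero] at h
      obtain ⟨⟨rfl, hy⟩, hz, rfl⟩ := h
      have hy := Units.ext hy
      subst hy
      simp at hz
      rw [Units.ext hz]
    · intro W hW
      simp only [Finset.mem_filter, Finset.mem_univ, true_and] at hW
      refine ⟨⟨Units.mk0 _ hW, Units.mk0 _ (hdet W), W 0 0, W 1 1⟩, Finset.mem_univ _, ?_⟩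
      ext i j
      fin_cases i <;> fin_cases j <;>
        simp [GeneralLinearGroup.mkOfDetNeZero, det_fin_two]
      field_simp
    · intro p _
      rw [← AddChar.map_add_eq_mul]
      congr 1
      have hv : ∀ (M : Matrix (Fin 2) (Fin 2) F) (h : M.det ≠ 0),
        ((GeneralLinearGroup.mkOfDetNeZero M h : GL (Fin 2) F) : Matrix (Fin 2) (Fin 2) F) = M :=
        fun _ _ => rfl
      rw [hv, hm, trace_fin_two_of]
      ring
  have hc : ((Fintype.card Fˣ : ℕ) : ℂ) = Fintype.card F - 1 := by
    rw [Fintype.card_units, Nat.cast_sub Fintype.card_pos, Nat.cast_one]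
  have h3 : ∑ p : Fˣ × Fˣ × F, canonicalChar F (a * (p.1 + (p.1 : F)⁻¹)) *
        canonicalChar F (a * (p.2.1 + (p.2.1 : F)⁻¹)) =
      Fintype.card F * kloosterman 1 (canonicalChar F) a ^ 2 := by
    have hK := kloosterman_one_scaled (Units.mk0 a ha)
    rw [Units.val_mk0, kloosterman_one_sq] at hK
    rw [← hK, sq, Finset.sum_mul_sum, Finset.mul_sum, Fintype.sum_prod_type]
    refine Fintype.sum_congr _ _ fun x => ?_
    rw [Fintype.sum_prod_type, Finset.mul_sum]
    refine Fintype.sum_congr _ _ fun y => ?_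
    simp
  have h4 : ∑ p : Fˣ × Fˣ × F × F, canonicalChar F ((a * (1 + (p.2.1 : F)⁻¹)) * p.2.2.1) *
        canonicalChar F ((a * (1 + (p.2.1 : F)⁻¹)) * p.2.2.2) =
      (Fintype.card F - 1) * (Fintype.card F : ℂ) ^ 2 := by
    rw [Fintype.sum_prod_type, ← hc]
    simp only [Fintype.sum_prod_type (α₁ := Fˣ), Fintype.sum_prod_type (α₁ := F),
      ← Finset.sum_mul_sum, sum_canonicalChar_mul]
    have : ∀ d : Fˣ, a * (1 + (d : F)⁻¹) = 0 ↔ d = 1 := by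
      intro d
      rw [mul_eq_zero, or_iff_right ha, CharTwo.add_eq_zero, eq_comm, inv_eq_one,
        Units.val_eq_one]
    simp [this, sq]
  rw [h1, h2, h3, h4]
  ring

end GLSums

/-! ### Class functions summed over a double coset. -/

section DoubleCosetSums

/-- Summing a class function over a double coset `Q s Q` of a finite group of units. -/
theorem card_mul_sum_doubleCoset {M : Type*} [Monoid M] (Q : Subgroup Mˣ) [Fintype Q] (s : Mˣ)
    (D : Set M) [Fintype D] (hD : D = DoubleCoset.doubleCoset (s : M) ((fun u : Mˣ => (u : M)) '' Q)
      ((fun u : Mˣ => (u : M)) '' Q)) (f : M → ℂ) (hf : ∀ x y, f (x * y) = f (y * x)) :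
    (Nat.card {p : Q // s⁻¹ * p * s ∈ Q} : ℂ) * ∑ g : D, f g =
      Fintype.card Q * ∑ w : Q, f ((w : Mˣ) * s) := by
  classical
  have hmem : ∀ p : Q × Q, (((p.1 : Mˣ) * s * p.2 : Mˣ) : M) ∈ D := by
    intro p
    rw [hD, DoubleCoset.mem_doubleCoset]
    exact ⟨_, ⟨_, p.1.2, rfl⟩, _, ⟨_, p.2.2, rfl⟩, by simp⟩
  let φ : Q × Q → D := fun p => ⟨_, hmem p⟩
  -- Over g = xsy, the pair (p₁, p₂) corresponds to x⁻¹p₁; the equation p₁sp₂ = xsy then determines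
  -- p₂ and puts s⁻¹(x⁻¹p₁)s in Q.
  have hfib : ∀ g : D, Fintype.card {p : Q × Q // φ p = g} =
      Nat.card {p : Q // s⁻¹ * p * s ∈ Q} := by
    rintro ⟨g, hg⟩
    rw [hD, DoubleCoset.mem_doubleCoset] at hg
    obtain ⟨_, ⟨x, hx, rfl⟩, _, ⟨y, hy, rfl⟩, rfl⟩ := hg
    rw [← Nat.card_eq_fintype_card]
    have key : ∀ p : Q × Q, φ p = ⟨(x : M) * s * y, hg⟩ ↔
        (p.1 : Mˣ) * s * p.2 = x * s * y := by
      intro p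
      simp only [φ, Subtype.mk.injEq, Units.ext_iff, Units.val_mul]
    refine Nat.card_congr
      { toFun := fun p => ⟨⟨x, hx⟩⁻¹ * p.1.1, ?_⟩
        invFun := fun p => ⟨(⟨x, hx⟩ * p.1, ⟨_, inv_mem p.2⟩ * ⟨y, hy⟩), ?_⟩
        left_inv := ?_
        right_inv := ?_ }
    · have h := (key p.1).1 p.2
      have h' : s⁻¹ * ((⟨x, hx⟩⁻¹ * p.1.1 : Q) : Mˣ) * s = y * (p.1.2 : Mˣ)⁻¹ := by
        rw [eq_mul_inv_iff_mul_eq]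
        simp only [Subgroup.coe_mul, Subgroup.coe_inv]
        rw [mul_assoc, mul_assoc, mul_assoc, ← mul_assoc _ s, h]
        group
      rw [h']
      exact mul_mem hy (inv_mem p.1.2.2)
    · rw [key]
      simp only [Subgroup.coe_mul]
      group
    · rintro ⟨p, hp⟩
      have h := (key p).1 hp
      ext
      · simp
      · simp only [Subgroup.coe_mul, Subgroup.coe_inv]
        have h2 : (p.2 : Mˣ) = s⁻¹ * (p.1 : Mˣ)⁻¹ * (x * s * y) := by
          rw [← h]
          group
        rw [h2]
        congr 1
        group
    · rintro ⟨p, hp⟩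
      simp
  have h1 : ∑ p : Q × Q, f (φ p) = Fintype.card Q * ∑ w : Q, f ((w : Mˣ) * s) := by
    -- Cyclic invariance moves p₂ to the front, so only the product p₂p₁ matters.
    have hrot : ∀ p : Q × Q, f (φ p) = f (((p.2 * p.1 : Q) : Mˣ) * s) := by
      intro p
      simp only [φ, Units.val_mul, Subgroup.coe_mul]
      rw [hf, mul_assoc]
    simp only [hrot]
    rw [Fintype.sum_prod_type_right]
    have hin : ∀ y : Q, ∑ x : Q, f (((y * x : Q) : Mˣ) * s) = ∑ w : Q, f ((w : Mˣ) * s) :=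
      fun y => Fintype.sum_equiv (Equiv.mulLeft y) _ _ fun x => rfl
    rw [Fintype.sum_congr _ _ hin]
    simp
  rw [← h1, ← Fintype.sum_fiberwise φ, Finset.mul_sum]
  refine Fintype.sum_congr _ _ fun g => ?_
  rw [← hfib g, Finset.sum_congr rfl fun i _ => by rw [i.2]]
  simp

end DoubleCosetSums

/-! ### Symmetric matrices and nonsingular alternating matrices. -/

section Counting

variable {F : Type*} [Field F]

/-- The additive group of symmetric matrices. -/
def symmetricMatrices (F : Type*) [Field F] (ι : Type*) : AddSubgroup (Matrix ι ι F) where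
  carrier := {B | Bᵀ = B}
  zero_mem' := transpose_zero
  add_mem' {B C} hB hC := by
    change (B + C)ᵀ = B + C
    rw [transpose_add, show Bᵀ = B from hB, show Cᵀ = C from hC]
  neg_mem' {B} hB := by
    change (-B)ᵀ = -B
    rw [transpose_neg, show Bᵀ = B from hB]

theorem mem_symmetricMatrices {ι : Type*} {B : Matrix ι ι F} :
    B ∈ symmetricMatrices F ι ↔ Bᵀ = B := Iff.rfl

/-- A symmetric matrix is a function on unordered pairs of indices. -/
theorem card_symmetricMatrices (n : ℕ) [Fintype F] :
    Nat.card (symmetricMatrices F (Fin n)) = Fintype.card F ^ (n + 1).choose 2 := by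
  have e : symmetricMatrices F (Fin n) ≃ (Sym2 (Fin n) → F) :=
    (Equiv.subtypeEquivRight fun B => by
      rw [mem_symmetricMatrices, ← Matrix.ext_iff, forall_comm]
      exact Iff.rfl).trans Sym2.lift
  rw [Nat.card_congr e, Nat.card_eq_fintype_card, Fintype.card_fun, Sym2.card, Fintype.card_fin]

/-- Alternating matrices: skew-symmetric with zero diagonal. -/
def IsAlternating {ι : Type*} (M : Matrix ι ι F) : Prop := Mᵀ = -M ∧ ∀ i, M i i = 0

/-- The right-hand condition is basis-free, which makes invariance under congruence immediate.
Forward, the terms at (i, j) and (j, i) cancel; backward, test on basis vectors and their pairwise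
sums. -/
theorem isAlternating_iff {ι : Type*} [Fintype ι] [DecidableEq ι] {M : Matrix ι ι F} :
    IsAlternating M ↔ ∀ v, v ⬝ᵥ M *ᵥ v = 0 := by
  constructor
  · rintro ⟨h1, h2⟩ v
    have h1' : ∀ i j, M j i = - M i j := fun i j => congrFun (congrFun h1 i) j
    simp only [dotProduct, mulVec, Finset.mul_sum]
    rw [← Finset.sum_product']
    refine Finset.sum_involution (fun p _ => p.swap) ?_ ?_ ?_ ?_
    · rintro ⟨i, j⟩ _
      simp only [Prod.swap]
      rw [h1' i j]
      ring
    · rintro ⟨i, j⟩ _ h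
      simp only [Prod.swap, ne_eq, Prod.mk.injEq, not_and]
      rintro rfl
      simp [h2] at h
    · simp
    · simp
  · intro h
    have hd : ∀ i, M i i = 0 := fun i => by simpa using h (Pi.single i 1)
    refine ⟨?_, hd⟩
    ext i j
    have h3 := h (Pi.single i 1 + Pi.single j 1)
    simp [mulVec_add, dotProduct_add, add_dotProduct, hd] at h3
    rw [transpose_apply, Matrix.neg_apply]
    linear_combination h3

theorem IsAlternating.congr {ι κ : Type*} [Fintype ι] [DecidableEq ι] [Fintype κ] [DecidableEq κ]
    {M : Matrix ι ι F} (h : IsAlternating M) (g : Matrix κ ι F) : IsAlternating (g * M * gᵀ) := by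
  rw [isAlternating_iff] at h ⊢
  intro v
  rw [← mulVec_mulVec, ← mulVec_mulVec, dotProduct_mulVec, ← mulVec_transpose]
  exact h _

theorem IsAlternating.submatrix {ι κ : Type*} {M : Matrix ι ι F} (h : IsAlternating M)
    (e : κ → ι) : IsAlternating (M.submatrix e e) :=
  ⟨by rw [transpose_submatrix, h.1, submatrix_neg]; rfl, fun i => h.2 _⟩

/-- Bordering of a square matrix by a column `v` and the row `-v`. -/
def border {κ : Type*} (v : κ → F) (C : Matrix κ κ F) : Matrix (Unit ⊕ κ) (Unit ⊕ κ) F :=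
  fromBlocks 0 (replicateRow Unit (-v)) (replicateCol Unit v) C

theorem isAlternating_border {κ : Type*} (v : κ → F) {C : Matrix κ κ F} (hC : IsAlternating C) :
    IsAlternating (border v C) := by
  refine ⟨?_, ?_⟩
  · rw [border, fromBlocks_transpose, fromBlocks_neg, hC.1]
    congr 1 <;> ext <;> simp
  · rintro (i | i)
    · rfl
    · exact hC.2 i

/-- An alternating matrix is a bordered alternating matrix. -/
def borderEquiv (κ : Type*) : (κ → F) × {C : Matrix κ κ F // IsAlternating C} ≃
    {M : Matrix (Unit ⊕ κ) (Unit ⊕ κ) F // IsAlternating M} where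
  toFun p := ⟨border p.1 p.2, isAlternating_border p.1 p.2.2⟩
  invFun M := (fun i => M.1 (Sum.inr i) (Sum.inl ()), ⟨M.1.submatrix Sum.inr Sum.inr,
    M.2.submatrix _⟩)
  left_inv p := rfl
  right_inv M := by
    obtain ⟨M, h1, h2⟩ := M
    ext i j
    rcases i with i | i <;> rcases j with j | j
    · exact (h2 (Sum.inl i)).symm
    · exact (congrFun (congrFun h1 (Sum.inr j)) (Sum.inl i)).symm
    · rfl
    · rfl

/-- The number of nonsingular alternating matrices. -/
def altCount (F : Type*) [Field F] (ι : Type*) [Fintype ι] [DecidableEq ι] : ℕ :=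
  Nat.card {M : Matrix ι ι F // IsAlternating M ∧ IsUnit M}

theorem altCount_congr {ι κ : Type*} [Fintype ι] [DecidableEq ι] [Fintype κ] [DecidableEq κ]
    (e : ι ≃ κ) : altCount F ι = altCount F κ := by
  refine Nat.card_congr ((reindex e e).subtypeEquiv fun M => and_congr ?_ ?_)
  · refine ⟨fun h => h.submatrix _, fun h => ?_⟩
    simpa using h.submatrix e
  · simp

theorem altCount_eq_one (ι : Type*) [Fintype ι] [DecidableEq ι] [IsEmpty ι] :
    altCount F ι = 1 := by
  rw [altCount, Nat.card_eq_one_iff_unique]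
  refine ⟨inferInstance, ⟨1, ⟨?_, ?_⟩, isUnit_one⟩⟩
  · ext i; exact isEmptyElim i
  · exact isEmptyElim

/-- The isomorphism between the two lines extends to an automorphism of the whole space. -/
theorem exists_GL_mulVec_eq {κ : Type*} [Fintype κ] [DecidableEq κ] {v w : κ → F} (hv : v ≠ 0)
    (hw : w ≠ 0) : ∃ g : GL κ F, (g : Matrix κ κ F) *ᵥ v = w := by
  let f := (LinearEquiv.toSpanNonzeroSingleton F _ v hv).symm ≪≫ₗ
    LinearEquiv.toSpanNonzeroSingleton F _ w hw
  obtain ⟨g, hg⟩ := Submodule.exists_linearEquiv_restrict_eq f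
  have hgv : g v = w := by
    have h := hg (LinearEquiv.toSpanNonzeroSingleton F _ v hv 1)
    simp only [f, LinearEquiv.trans_apply, LinearEquiv.symm_apply_apply] at h
    simpa using h.symm
  refine ⟨GeneralLinearGroup.toLin.symm (LinearMap.GeneralLinearGroup.ofLinearEquiv g), ?_⟩
  have h := GeneralLinearGroup.toLin_apply
    (GeneralLinearGroup.toLin.symm (LinearMap.GeneralLinearGroup.ofLinearEquiv g)) v
  rw [MulEquiv.apply_symm_apply] at h
  exact h.symm.trans hgv

/-- The number of alternating matrices whose bordering by `v` is nonsingular. -/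
def borderCount {κ : Type*} [Fintype κ] [DecidableEq κ] (v : κ → F) : ℕ :=
  Nat.card {C : Matrix κ κ F // IsAlternating C ∧ IsUnit (border v C)}

/-- Congruence by diag(1, g) moves the bordering vector by g; hence the number of nonsingular
borderings is constant on nonzero vectors. -/
theorem border_congr {κ : Type*} [Fintype κ] [DecidableEq κ] (v : κ → F) (C g : Matrix κ κ F) :
    border (g *ᵥ v) (g * C * gᵀ) = fromBlocks 1 0 0 g * border v C * (fromBlocks 1 0 0 g)ᵀ := by
  simp only [border, fromBlocks_transpose, fromBlocks_multiply]
  congr 1 <;> ext <;> simp [mul_apply, mulVec, dotProduct, mul_comm]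

theorem borderCount_mulVec {κ : Type*} [Fintype κ] [DecidableEq κ] (v : κ → F) (g : GL κ F) :
    borderCount ((g : Matrix κ κ F) *ᵥ v) = borderCount v := by
  symm
  have hg : IsUnit (fromBlocks (1 : Matrix Unit Unit F) 0 0 (g : Matrix κ κ F)) := by
    rw [isUnit_fromBlocks_zero₁₂]
    exact ⟨isUnit_one, g.isUnit⟩
  have h1 : ((g⁻¹ : GL κ F) : Matrix κ κ F) * g = 1 := g.inv_mul
  have h2 : (g : Matrix κ κ F) * ((g⁻¹ : GL κ F) : Matrix κ κ F) = 1 := g.mul_inv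
  have h1' : (g : Matrix κ κ F)ᵀ * ((g⁻¹ : GL κ F) : Matrix κ κ F)ᵀ = 1 := by
    rw [← transpose_mul, h1, transpose_one]
  have h2' : ((g⁻¹ : GL κ F) : Matrix κ κ F)ᵀ * (g : Matrix κ κ F)ᵀ = 1 := by
    rw [← transpose_mul, h2, transpose_one]
  let e : Matrix κ κ F ≃ Matrix κ κ F :=
    { toFun := fun C => g * C * (g : Matrix κ κ F)ᵀ
      invFun := fun C => (g⁻¹ : GL κ F) * C * ((g⁻¹ : GL κ F) : Matrix κ κ F)ᵀ
      left_inv := fun C => by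
        beta_reduce
        rw [show ((g⁻¹ : GL κ F) : Matrix κ κ F) * (g * C * (g : Matrix κ κ F)ᵀ) *
          ((g⁻¹ : GL κ F) : Matrix κ κ F)ᵀ = ((g⁻¹ : GL κ F) : Matrix κ κ F) * g * C *
            ((g : Matrix κ κ F)ᵀ * ((g⁻¹ : GL κ F) : Matrix κ κ F)ᵀ) by
            simp only [Matrix.mul_assoc], h1, h1', one_mul, mul_one]
      right_inv := fun C => by
        beta_reduce
        rw [show (g : Matrix κ κ F) * (((g⁻¹ : GL κ F) : Matrix κ κ F) * C *
          ((g⁻¹ : GL κ F) : Matrix κ κ F)ᵀ) * (g : Matrix κ κ F)ᵀ =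
            (g : Matrix κ κ F) * ((g⁻¹ : GL κ F) : Matrix κ κ F) * C *
            (((g⁻¹ : GL κ F) : Matrix κ κ F)ᵀ * (g : Matrix κ κ F)ᵀ) by
            simp only [Matrix.mul_assoc], h2, h2', one_mul, mul_one] }
  refine Nat.card_congr (e.subtypeEquiv fun C => and_congr ⟨fun h => h.congr _, fun h => ?_⟩ ?_)
  · rw [← e.symm_apply_apply C]
    exact h.congr _
  · change _ ↔ IsUnit (border ((g : Matrix κ κ F) *ᵥ v) (g * C * (g : Matrix κ κ F)ᵀ))
    rw [border_congr]
    have hgt : IsUnit (fromBlocks (1 : Matrix Unit Unit F) 0 0 (g : Matrix κ κ F))ᵀ := by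
      rwa [isUnit_transpose]
    rw [hgt.mul_right_iff, hg.mul_left_iff]

theorem borderCount_eq {κ : Type*} [Fintype κ] [DecidableEq κ] {v w : κ → F} (hv : v ≠ 0)
    (hw : w ≠ 0) : borderCount v = borderCount w := by
  obtain ⟨g, rfl⟩ := exists_GL_mulVec_eq hv hw
  exact (borderCount_mulVec v g).symm

theorem borderCount_zero {κ : Type*} [Fintype κ] [DecidableEq κ] :
    borderCount (0 : κ → F) = 0 := by
  rw [borderCount, Nat.card_eq_zero]
  left
  refine ⟨fun ⟨C, _, h⟩ => ?_⟩
  rw [isUnit_iff_isUnit_det, det_eq_zero_of_row_eq_zero (Sum.inl ())] at h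
  · exact not_isUnit_zero h
  · rintro (j | j) <;> simp [border]

/-- The doubly bordered matrix sends (a, b, u) to (-b, a - w·u, bw + Du). A kernel vector has b = 0
and a = w·u, so the kernel is a copy of that of D, whatever w is. -/
theorem isUnit_border_border {μ : Type*} [Fintype μ] [DecidableEq μ] (w : μ → F)
    (D : Matrix μ μ F) :
    IsUnit (border (Sum.elim (fun _ => 1) 0) (border w D)) ↔ IsUnit D := by
  rw [isUnit_iff_isUnit_det, isUnit_iff_isUnit_det, isUnit_iff_ne_zero, isUnit_iff_ne_zero,
    not_iff_not, ← exists_mulVec_eq_zero_iff, ← exists_mulVec_eq_zero_iff]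
  have key : ∀ (a b : F) (u : μ → F), border (Sum.elim (fun _ => 1) 0) (border w D) *ᵥ
      Sum.elim (fun _ => a) (Sum.elim (fun _ => b) u) =
      Sum.elim (fun _ => -b) (Sum.elim (fun _ => a - w ⬝ᵥ u) (b • w + D *ᵥ u)) := by
    intro a b u
    ext (i | i | i) <;>
      simp [border, mulVec, dotProduct, mul_comm, sub_eq_add_neg]
  constructor
  · rintro ⟨x, hx, h⟩
    have hxe : x = Sum.elim (fun _ => x (Sum.inl ())) (Sum.elim (fun _ => x (Sum.inr (Sum.inl ())))
      fun i => x (Sum.inr (Sum.inr i))) := by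
      ext (i | i | i) <;> rfl
    rw [hxe, key] at h
    have h1 : x (Sum.inr (Sum.inl ())) = 0 := by simpa using congrFun h (Sum.inl ())
    have h2 := congrFun h (Sum.inr (Sum.inl ()))
    have h3 : ∀ i, _ := fun i => congrFun h (Sum.inr (Sum.inr i))
    simp only [Sum.elim_inr, Sum.elim_inl, h1, zero_smul, zero_add, Pi.zero_apply] at h2 h3
    refine ⟨fun i => x (Sum.inr (Sum.inr i)), fun h0 => hx ?_, funext h3⟩
    rw [h0, dotProduct_zero, sub_zero] at h2
    rw [hxe, h0, h1, h2]
    ext (i | i | i) <;> rfl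
  · rintro ⟨u, hu, h⟩
    refine ⟨Sum.elim (fun _ => w ⬝ᵥ u) (Sum.elim (fun _ => 0) u), fun h0 => hu ?_, ?_⟩
    · ext i
      exact congrFun h0 (Sum.inr (Sum.inr i))
    · rw [key, h]
      ext (i | i | i) <;> simp

theorem borderCount_single {μ : Type*} [Fintype μ] [DecidableEq μ] [Fintype F] :
    borderCount (Sum.elim (fun _ => 1) 0 : Unit ⊕ μ → F) =
      Fintype.card F ^ Fintype.card μ * altCount F μ := by
  have e : {C : Matrix (Unit ⊕ μ) (Unit ⊕ μ) F //
      IsAlternating C ∧ IsUnit (border (Sum.elim (fun _ => 1) 0) C)} ≃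
      (μ → F) × {D : Matrix μ μ F // IsAlternating D ∧ IsUnit D} :=
    calc _ ≃ {C : {C : Matrix (Unit ⊕ μ) (Unit ⊕ μ) F // IsAlternating C} //
          IsUnit (border (Sum.elim (fun _ => 1) 0) C.1)} :=
          (Equiv.subtypeSubtypeEquivSubtypeInter _ _).symm
      _ ≃ {p : (μ → F) × {D : Matrix μ μ F // IsAlternating D} // IsUnit p.2.1} :=
          ((borderEquiv μ).subtypeEquiv fun p => (isUnit_border_border p.1 p.2.1).symm).symm
      _ ≃ (μ → F) × {D : {D : Matrix μ μ F // IsAlternating D} // IsUnit D.1} :=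
          { toFun := fun p => (p.1.1, ⟨p.1.2, p.2⟩)
            invFun := fun p => ⟨(p.1, p.2.1), p.2.2⟩ }
      _ ≃ _ := Equiv.prodCongr (Equiv.refl _) (Equiv.subtypeSubtypeEquivSubtypeInter _ _)
  rw [borderCount, Nat.card_congr e, Nat.card_prod, altCount]
  simp [Nat.card_eq_fintype_card]

theorem altCount_unit_sum {κ : Type*} [Fintype κ] [DecidableEq κ] [Fintype F] :
    altCount F (Unit ⊕ κ) = ∑ v : κ → F, borderCount v := by
  have e : {M : Matrix (Unit ⊕ κ) (Unit ⊕ κ) F // IsAlternating M ∧ IsUnit M} ≃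
      Σ v : κ → F, {C : Matrix κ κ F // IsAlternating C ∧ IsUnit (border v C)} :=
    calc _ ≃ {M : {M : Matrix (Unit ⊕ κ) (Unit ⊕ κ) F // IsAlternating M} // IsUnit M.1} :=
          (Equiv.subtypeSubtypeEquivSubtypeInter _ _).symm
      _ ≃ {p : (κ → F) × {C : Matrix κ κ F // IsAlternating C} // IsUnit (border p.1 p.2.1)} :=
          ((borderEquiv κ).subtypeEquiv fun p => Iff.rfl).symm
      _ ≃ Σ v : κ → F, {C : {C : Matrix κ κ F // IsAlternating C} // IsUnit (border v C.1)} :=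
          Equiv.subtypeProdEquivSigmaSubtype fun v (C : {C : Matrix κ κ F // IsAlternating C}) =>
            IsUnit (border v C.1)
      _ ≃ _ := Equiv.sigmaCongrRight fun v =>
          Equiv.subtypeSubtypeEquivSubtypeInter IsAlternating fun C => IsUnit (border v C)
  rw [altCount, Nat.card_congr e, Nat.card_sigma]
  rfl

/-- Sort by the first column below its zero entry. The zero column contributes nothing; each of the
q^(n+1) - 1 others contributes as much as the first basis vector, where a second bordering leaves
q^n free vectors and a nonsingular matrix of size n. -/
theorem altCount_add_two (n : ℕ) [Fintype F] :
    altCount F (Fin (n + 2)) =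
      (Fintype.card F ^ (n + 1) - 1) * (Fintype.card F ^ n * altCount F (Fin n)) := by
  classical
  have e : Fin (n + 2) ≃ Unit ⊕ (Unit ⊕ Fin n) := Fintype.equivOfCardEq (by simp; ring)
  have h0 : (Sum.elim (fun _ => 1) 0 : Unit ⊕ Fin n → F) ≠ 0 := fun h =>
    one_ne_zero (congrFun h (Sum.inl ()))
  rw [altCount_congr e, altCount_unit_sum, ← Finset.add_sum_erase _ _ (Finset.mem_univ 0),
    borderCount_zero, zero_add, Finset.sum_congr rfl fun v hv =>
      (borderCount_eq (Finset.ne_of_mem_erase hv) h0).trans borderCount_single]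
  simp [Finset.card_erase_of_mem, add_comm 1 n]

/-- The number of nonsingular alternating matrices of size `2 m`. -/
theorem altCount_two_mul (m : ℕ) [Fintype F] :
    (altCount F (Fin (2 * m)) : ℂ) = (Fintype.card F : ℂ) ^ (m * (m - 1)) *
      ∏ j ∈ Finset.Icc 1 m, ((Fintype.card F : ℂ) ^ (2 * j - 1) - 1) := by
  induction m with
  | zero => simp [altCount_eq_one]
  | succ m ih =>
    rw [show 2 * (m + 1) = 2 * m + 2 by ring, altCount_add_two, Nat.cast_mul, Nat.cast_mul, ih,
      Finset.prod_Icc_succ_top (by omega), Nat.cast_sub (Nat.one_le_pow _ _ Fintype.card_pos)]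
    have h : (m + 1) * (m + 1 - 1) = 2 * m + m * (m - 1) := by
      rcases m with _ | m
      · rfl
      · simp; ring
    rw [h, pow_add, show 2 * (m + 1) - 1 = 2 * m + 1 by omega]
    push_cast
    ring

end Counting

/-! ### Block lower triangular matrices and the sum over A. -/

section BlockTriangular

variable {F : Type*} [Field F] {r k : ℕ}

/-- Identification of block matrices with matrices of size `r + k`. -/
def blockEquiv (F : Type*) [Field F] (r k : ℕ) :
    Matrix (Fin r ⊕ Fin k) (Fin r ⊕ Fin k) F ≃ₐ[F] Matrix (Fin (r + k)) (Fin (r + k)) F :=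
  reindexAlgEquiv F F finSumFinEquiv

theorem blockEquiv_apply (M : Matrix (Fin r ⊕ Fin k) (Fin r ⊕ Fin k) F) :
    blockEquiv F r k M = M.submatrix finSumFinEquiv.symm finSumFinEquiv.symm := rfl

theorem blockEquiv_firstOnes :
    blockEquiv F r k (fromBlocks 1 0 0 0) = firstOnes F (r + k) r := by
  rw [firstOnes]
  rw [← diagonal_one, ← diagonal_zero, fromBlocks_diagonal, blockEquiv_apply,
    submatrix_diagonal_equiv]
  congr 1
  ext i
  obtain ⟨i, rfl⟩ := finSumFinEquiv.surjective i
  rcases i with i | i <;> simp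

theorem blockEquiv_one_sub_firstOnes :
    blockEquiv F r k (fromBlocks 0 0 0 1) = 1 - firstOnes F (r + k) r := by
  rw [← blockEquiv_firstOnes, ← map_one (blockEquiv F r k), ← map_sub, ← fromBlocks_one,
    sub_eq_add_neg, fromBlocks_neg, fromBlocks_add]
  simp

theorem trace_blockEquiv (M : Matrix (Fin r ⊕ Fin k) (Fin r ⊕ Fin k) F) :
    (blockEquiv F r k M).trace = M.trace := by
  rw [blockEquiv_apply]
  exact Fintype.sum_equiv finSumFinEquiv.symm _ _ fun i => rfl

theorem trace_fromBlocks_eq {m n : Type*} [Fintype m] [Fintype n] (A : Matrix m m F)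
    (B : Matrix m n F) (C : Matrix n m F) (D : Matrix n n F) :
    (fromBlocks A B C D).trace = A.trace + D.trace := by
  simp [trace, Fintype.sum_sum_type]

theorem transpose_blockEquiv (M : Matrix (Fin r ⊕ Fin k) (Fin r ⊕ Fin k) F) :
    (blockEquiv F r k M)ᵀ = blockEquiv F r k Mᵀ := rfl

/-- The invertible block lower triangular matrix with diagonal blocks `X`, `W`. -/
def lowerUnit (X : GL (Fin r) F) (W : GL (Fin k) F) (Z : Matrix (Fin k) (Fin r) F) :
    GL (Fin r ⊕ Fin k) F where
  val := fromBlocks X 0 Z W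
  inv := fromBlocks (X⁻¹ : GL (Fin r) F) 0
    (-(((W⁻¹ : GL (Fin k) F) : Matrix (Fin k) (Fin k) F) * Z *
      ((X⁻¹ : GL (Fin r) F) : Matrix (Fin r) (Fin r) F)))
    (W⁻¹ : GL (Fin k) F)
  val_inv := by
    rw [fromBlocks_multiply, Units.mul_inv, Units.mul_inv, Matrix.mul_neg W.val,
      Matrix.mul_assoc (W⁻¹ : GL (Fin k) F).val, ← Matrix.mul_assoc W.val, Units.mul_inv]
    simp
  inv_val := by
    rw [fromBlocks_multiply, Units.inv_mul, Units.inv_mul, Matrix.neg_mul, Matrix.mul_assoc,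
      Units.inv_mul]
    simp

/-- Block lower triangular elements of `GL(r + k, F)`. -/
def lowerGL (p : GL (Fin r) F × GL (Fin k) F × Matrix (Fin k) (Fin r) F) : GL (Fin (r + k)) F :=
  Units.map (blockEquiv F r k : Matrix (Fin r ⊕ Fin k) (Fin r ⊕ Fin k) F →*
    Matrix (Fin (r + k)) (Fin (r + k)) F) (lowerUnit p.1 p.2.1 p.2.2)

theorem val_lowerGL (p : GL (Fin r) F × GL (Fin k) F × Matrix (Fin k) (Fin r) F) :
    (lowerGL p : Matrix (Fin (r + k)) (Fin (r + k)) F) =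
      blockEquiv F r k (fromBlocks p.1 0 p.2.2 p.2.1) := rfl

theorem val_lowerGL_inv (p : GL (Fin r) F × GL (Fin k) F × Matrix (Fin k) (Fin r) F) :
    (((lowerGL p)⁻¹ : GL (Fin (r + k)) F) : Matrix (Fin (r + k)) (Fin (r + k)) F) =
      blockEquiv F r k (fromBlocks (p.1⁻¹ : GL (Fin r) F) 0
        (-(((p.2.1⁻¹ : GL (Fin k) F) : Matrix (Fin k) (Fin k) F) * p.2.2 *
          ((p.1⁻¹ : GL (Fin r) F) : Matrix (Fin r) (Fin r) F)))
        (p.2.1⁻¹ : GL (Fin k) F)) := rfl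

theorem firstOnes_mul_lowerGL (p : GL (Fin r) F × GL (Fin k) F × Matrix (Fin k) (Fin r) F) :
    firstOnes F (r + k) r * (lowerGL p : Matrix (Fin (r + k)) (Fin (r + k)) F) =
      blockEquiv F r k (fromBlocks p.1 0 0 0) := by
  rw [val_lowerGL, ← blockEquiv_firstOnes, ← map_mul, fromBlocks_multiply]
  simp

theorem lowerGL_mem (p : GL (Fin r) F × GL (Fin k) F × Matrix (Fin k) (Fin r) F) :
    firstOnes F (r + k) r * (lowerGL p : Matrix (Fin (r + k)) (Fin (r + k)) F) *
      (1 - firstOnes F (r + k) r) = 0 := by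
  rw [firstOnes_mul_lowerGL, ← blockEquiv_one_sub_firstOnes, ← map_mul, fromBlocks_multiply]
  simp

/-- The block lower triangular subgroup of `GL(r + k, F)` in terms of the blocks. -/
def lowerEquiv (F : Type*) [Field F] (r k : ℕ) :
    GL (Fin r) F × GL (Fin k) F × Matrix (Fin k) (Fin r) F ≃
    {A : GL (Fin (r + k)) F // firstOnes F (r + k) r * (A : Matrix (Fin (r + k)) (Fin (r + k)) F) *
      (1 - firstOnes F (r + k) r) = 0} :=
  Equiv.ofBijective (fun p => ⟨lowerGL p, lowerGL_mem p⟩) <| by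
    constructor
    · rintro ⟨X, W, Z⟩ ⟨X', W', Z'⟩ h
      have h1 := congrArg Units.val (congrArg Subtype.val h)
      rw [val_lowerGL, val_lowerGL, (blockEquiv F r k).injective.eq_iff, fromBlocks_inj] at h1
      obtain ⟨hX, -, hZ, hW⟩ := h1
      exact Prod.ext (Units.ext hX) (Prod.ext (Units.ext hW) hZ)
    · rintro ⟨A, hA⟩
      obtain ⟨M, hM⟩ := (blockEquiv F r k).surjective (A : Matrix (Fin (r + k)) (Fin (r + k)) F)
      have hu : IsUnit M := by
        rw [← isUnit_map_iff (blockEquiv F r k), hM]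
        exact A.isUnit
      rw [← fromBlocks_toBlocks M] at hM hu
      rw [← hM, ← blockEquiv_one_sub_firstOnes, ← blockEquiv_firstOnes, ← map_mul, ← map_mul,
        EmbeddingLike.map_eq_zero_iff, fromBlocks_multiply, fromBlocks_multiply,
        ← fromBlocks_zero, fromBlocks_inj] at hA
      have hY : M.toBlocks₁₂ = 0 := by simpa using hA.2.1
      rw [hY, isUnit_fromBlocks_zero₁₂] at hu
      refine ⟨⟨hu.1.unit, hu.2.unit, M.toBlocks₂₁⟩, Subtype.ext (Units.ext ?_)⟩
      rw [val_lowerGL, ← hM, hY]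
      rfl

theorem lowerEquiv_val (p : GL (Fin r) F × GL (Fin k) F × Matrix (Fin k) (Fin r) F) :
    (lowerEquiv F r k p : GL (Fin (r + k)) F) = lowerGL p := rfl

theorem card_matrix {F : Type*} [Fintype F] (k r : ℕ) :
    Nat.card (Matrix (Fin k) (Fin r) F) = Fintype.card F ^ (k * r) := by
  change Nat.card (Fin k → Fin r → F) = _
  simp [Nat.card_eq_fintype_card, ← pow_mul, mul_comm]

theorem card_lower (F : Type*) [Field F] [Fintype F] (r k : ℕ) :
    Nat.card {A : GL (Fin (r + k)) F // firstOnes F (r + k) r *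
      (A : Matrix (Fin (r + k)) (Fin (r + k)) F) * (1 - firstOnes F (r + k) r) = 0} =
      Nat.card (GL (Fin r) F) * (Nat.card (GL (Fin k) F) * Fintype.card F ^ (k * r)) := by
  rw [← Nat.card_congr (lowerEquiv F r k), Nat.card_prod, Nat.card_prod]
  congr 2
  exact card_matrix k r

/-- This transfers the condition on EA to the corner block X of A. -/
theorem isAlternating_blockEquiv (X : Matrix (Fin r) (Fin r) F) :
    IsAlternating (blockEquiv F r k (fromBlocks X 0 0 0)) ↔ IsAlternating X := by
  rw [IsAlternating, IsAlternating, transpose_blockEquiv, ← map_neg,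
    (blockEquiv F r k).injective.eq_iff, fromBlocks_transpose, fromBlocks_neg, fromBlocks_inj]
  refine and_congr (by simp) ⟨fun h i => ?_, fun h i => ?_⟩
  · simpa [blockEquiv_apply] using h (Fin.castAdd k i)
  · obtain ⟨i, rfl⟩ := finSumFinEquiv.surjective i
    rcases i with i | i <;> simp [blockEquiv_apply, h]

theorem firstOnes_mul_self (n r : ℕ) : firstOnes F n r * firstOnes F n r = firstOnes F n r := by
  simp [firstOnes, diagonal_mul_diagonal]

theorem transpose_firstOnes (n r : ℕ) : (firstOnes F n r)ᵀ = firstOnes F n r := by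
  simp [firstOnes]

/-- Skew symmetry gives EA = -AᵀE, which is annihilated by 1 - E on the right. -/
theorem firstOnes_mul_mul_of_isAlternating {n r : ℕ} {A : Matrix (Fin n) (Fin n) F}
    (h : IsAlternating (firstOnes F n r * A)) :
    firstOnes F n r * A * (1 - firstOnes F n r) = 0 := by
  have h1 := h.1
  rw [transpose_mul, transpose_firstOnes, eq_neg_iff_add_eq_zero, add_comm,
    ← eq_neg_iff_add_eq_zero] at h1
  rw [h1, Matrix.neg_mul, Matrix.mul_assoc, Matrix.mul_sub, firstOnes_mul_self]
  simp

-- Only block lower triangular A contribute. There the condition involves X alone and the traces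
-- involve W alone, so the sum factors, with Z contributing q^(kr).
open scoped Classical in
theorem sum_isAlternating_firstOnes_mul [Fintype F] [DecidableEq F] [Algebra (ZMod 2) F] (r k : ℕ) (a : F) :
    ∑ A : GL (Fin (r + k)) F, (if IsAlternating (firstOnes F (r + k) r *
        (A : Matrix (Fin (r + k)) (Fin (r + k)) F)) then
      canonicalChar F (a * (((A : Matrix (Fin (r + k)) (Fin (r + k)) F) *
        (1 - firstOnes F (r + k) r)).trace +
        (((A⁻¹ : GL (Fin (r + k)) F) : Matrix (Fin (r + k)) (Fin (r + k)) F) *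
        (1 - firstOnes F (r + k) r)).trace)) else 0) =
      altCount F (Fin r) * ((Fintype.card F : ℂ) ^ (k * r) * glKloosterman k a) := by
  set g : GL (Fin (r + k)) F → ℂ := fun A => if IsAlternating (firstOnes F (r + k) r *
        (A : Matrix (Fin (r + k)) (Fin (r + k)) F)) then
      canonicalChar F (a * (((A : Matrix (Fin (r + k)) (Fin (r + k)) F) *
        (1 - firstOnes F (r + k) r)).trace +
        (((A⁻¹ : GL (Fin (r + k)) F) : Matrix (Fin (r + k)) (Fin (r + k)) F) *
        (1 - firstOnes F (r + k) r)).trace)) else 0 with hg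
  have h0 : ∑ A, g A = ∑ A : {A : GL (Fin (r + k)) F // firstOnes F (r + k) r *
      (A : Matrix (Fin (r + k)) (Fin (r + k)) F) * (1 - firstOnes F (r + k) r) = 0}, g A := by
    rw [← Finset.sum_filter_of_ne (p := fun A : GL (Fin (r + k)) F => firstOnes F (r + k) r *
      (A : Matrix (Fin (r + k)) (Fin (r + k)) F) * (1 - firstOnes F (r + k) r) = 0)]
    · exact Finset.sum_subtype _ (by simp) g
    · intro A _ hA
      by_contra hn
      refine hA (if_neg fun h => hn (firstOnes_mul_mul_of_isAlternating h))
  have h1 : ∀ p, g (lowerGL p) = if IsAlternating (p.1 : Matrix (Fin r) (Fin r) F) then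
      canonicalChar F (a * ((p.2.1 : Matrix (Fin k) (Fin k) F).trace +
        ((p.2.1⁻¹ : GL (Fin k) F) : Matrix (Fin k) (Fin k) F).trace)) else 0 := by
    intro p
    simp only [hg]
    rw [firstOnes_mul_lowerGL, val_lowerGL, val_lowerGL_inv, ← blockEquiv_one_sub_firstOnes,
      ← map_mul, ← map_mul, trace_blockEquiv, trace_blockEquiv, fromBlocks_multiply,
      fromBlocks_multiply, trace_fromBlocks_eq, trace_fromBlocks_eq]
    simp only [isAlternating_blockEquiv]
    simp
  change ∑ A, g A = _
  rw [h0, ← Equiv.sum_comp (lowerEquiv F r k)]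
  simp only [lowerEquiv_val, h1]
  have h2 : (altCount F (Fin r) : ℂ) =
      ∑ X : GL (Fin r) F, if IsAlternating (X : Matrix (Fin r) (Fin r) F) then 1 else 0 := by
    rw [Finset.sum_boole, ← Fintype.card_subtype, ← Nat.card_eq_fintype_card, altCount]
    congr 1
    exact Nat.card_congr
      { toFun := fun M => ⟨M.2.2.unit, M.2.1⟩
        invFun := fun X => ⟨X.1, X.2, X.1.isUnit⟩
        left_inv := fun M => rfl
        right_inv := fun X => Subtype.ext (Units.ext rfl) }
  rw [Fintype.sum_prod_type, h2, Finset.sum_mul]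
  refine Fintype.sum_congr _ _ fun X => ?_
  split_ifs
  · rw [Fintype.sum_prod_type, one_mul, glKloosterman, Finset.mul_sum]
    refine Fintype.sum_congr _ _ fun W => ?_
    change ∑ y : Matrix (Fin k) (Fin r) F, canonicalChar F (a *
      ((W : Matrix (Fin k) (Fin k) F).trace +
        ((W⁻¹ : GL (Fin k) F) : Matrix (Fin k) (Fin k) F).trace)) = _
    rw [Finset.sum_const, Finset.card_univ, nsmul_eq_mul, ← Nat.card_eq_fintype_card, card_matrix,
      Nat.cast_pow]
  · simp

/-- Restriction to the leading r × r block is a surjective homomorphism of symmetric matrices, and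
its kernel is the set counted on the left. -/
theorem card_symmetric_firstOnes (F : Type*) [Field F] [Fintype F] (r k : ℕ) :
    Nat.card {B : symmetricMatrices F (Fin (r + k)) // firstOnes F (r + k) r *
      (B : Matrix (Fin (r + k)) (Fin (r + k)) F) * firstOnes F (r + k) r = 0} *
      Nat.card (symmetricMatrices F (Fin r)) =
    Nat.card (symmetricMatrices F (Fin (r + k))) := by
  let θ : symmetricMatrices F (Fin (r + k)) →+ symmetricMatrices F (Fin r) :=
    { toFun := fun B => ⟨B.1.submatrix (Fin.castAdd k) (Fin.castAdd k), by
        rw [mem_symmetricMatrices, transpose_submatrix, B.2]⟩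
      map_zero' := rfl
      map_add' := fun _ _ => rfl }
  have hθ : ∀ B i j, (θ B).1 i j = B.1 (Fin.castAdd k i) (Fin.castAdd k j) := fun _ _ _ => rfl
  have hsurj : Function.Surjective θ := by
    rintro ⟨C, hC⟩
    refine ⟨⟨blockEquiv F r k (fromBlocks C 0 0 0), ?_⟩, ?_⟩
    · rw [mem_symmetricMatrices, transpose_blockEquiv, fromBlocks_transpose, hC]
      simp
    · ext i j
      rw [hθ]
      simp [blockEquiv_apply]
  have hker : ∀ B : symmetricMatrices F (Fin (r + k)), B ∈ θ.ker ↔ firstOnes F (r + k) r *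
      (B : Matrix (Fin (r + k)) (Fin (r + k)) F) * firstOnes F (r + k) r = 0 := by
    intro B
    obtain ⟨M, hM⟩ := (blockEquiv F r k).surjective B.1
    rw [← fromBlocks_toBlocks M] at hM
    rw [← hM, ← blockEquiv_firstOnes, ← map_mul, ← map_mul, EmbeddingLike.map_eq_zero_iff,
      fromBlocks_multiply, fromBlocks_multiply, ← fromBlocks_zero, fromBlocks_inj,
      AddMonoidHom.mem_ker, Subtype.ext_iff]
    have : (θ B).1 = M.toBlocks₁₁ := by
      ext i j
      rw [hθ, ← hM]
      simp [blockEquiv_apply]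
    rw [this]
    simp
  rw [← AddSubgroup.card_mul_index θ.ker, AddSubgroup.index_ker,
    AddMonoidHom.range_eq_top.2 hsurj, AddSubgroup.card_top]
  congr 1
  exact Nat.card_congr (Equiv.subtypeEquivRight fun B => (hker B).symm)

end BlockTriangular

/-! ### The parabolic subgroup and its intersection with its conjugate. -/

section Parabolic

variable {F : Type*} [Field F] {n : ℕ}

theorem sigma_zero : sigma F n 0 = 1 := by
  simp [sigma, firstOnes]

theorem sigma_mul_self [CharP F 2] (r : ℕ) : sigma F n r * sigma F n r = 1 := by
  have hE := firstOnes_mul_self (F := F) n r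
  rw [sigma, fromBlocks_multiply, ← fromBlocks_one]
  congr 1 <;> simp [mul_sub, sub_mul, hE]

theorem parabolic_subset_symplecticGroup [CharP F 2] {w : Matrix (Fin n ⊕ Fin n) (Fin n ⊕ Fin n) F}
    (hw : w ∈ parabolic F n) : w ∈ symplecticGroup (Fin n) F := by
  -- Since σ_0 = 1, the element w = 1·σ_0·w lies in a double coset already known to be symplectic.
  refine PsigmaP_subset_symplecticGroup F n 0 (DoubleCoset.mem_doubleCoset.2 ⟨1, ?_, w, hw, ?_⟩)
  · exact ⟨1, 0, by simp, by simp⟩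
  · rw [sigma_zero]; simp

theorem one_mem_parabolic : (1 : Matrix (Fin n ⊕ Fin n) (Fin n ⊕ Fin n) F) ∈ parabolic F n :=
  ⟨1, 0, by simp, by simp⟩

theorem sigma_mem_symplecticGroup [CharP F 2] (r : ℕ) :
    sigma F n r ∈ symplecticGroup (Fin n) F :=
  PsigmaP_subset_symplecticGroup F n r (DoubleCoset.mem_doubleCoset.2
    ⟨1, one_mem_parabolic, 1, one_mem_parabolic, by simp⟩)

/-- P is the stabiliser of a Lagrangian subspace. For symplectic matrices membership is therefore
the vanishing of one block, which also settles conjugates by σ. -/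
theorem mem_parabolic_iff [CharP F 2] {w : Matrix (Fin n ⊕ Fin n) (Fin n ⊕ Fin n) F} :
    w ∈ parabolic F n ↔ w ∈ symplecticGroup (Fin n) F ∧ w.toBlocks₂₁ = 0 := by
  constructor
  · intro hw
    refine ⟨parabolic_subset_symplecticGroup hw, ?_⟩
    obtain ⟨A, B, -, rfl⟩ := hw
    rw [fromBlocks_multiply, toBlocks_fromBlocks₂₁]
    simp
  · rintro ⟨hw, h0⟩
    rw [← fromBlocks_toBlocks w, h0] at hw ⊢
    set X := w.toBlocks₁₁
    set Y := w.toBlocks₁₂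
    set W := w.toBlocks₂₂
    rw [SymplecticGroup.mem_iff, J, fromBlocks_transpose, fromBlocks_multiply, fromBlocks_multiply,
      fromBlocks_inj] at hw
    obtain ⟨h1, h2, -, -⟩ := hw
    have hXW : X * Wᵀ = 1 := by simpa using h2
    have hYX : Y * Xᵀ = X * Yᵀ := by simpa [add_neg_eq_zero] using h1
    have hWX : Wᵀ * X = 1 := mul_eq_one_comm.1 hXW
    have hXW' : Xᵀ * W = 1 := by rw [← transpose_transpose W, ← transpose_mul, hWX, transpose_one]
    -- The symplectic relations give Wᵀ = X⁻¹, so B has to be X⁻¹Y.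
    refine ⟨⟨X, Wᵀ, hXW, hWX⟩, Wᵀ * Y, ?_, ?_⟩
    · rw [transpose_mul, transpose_transpose]
      calc Yᵀ * W = (Wᵀ * X) * Yᵀ * W := by rw [hWX, one_mul]
        _ = Wᵀ * (Y * Xᵀ) * W := by rw [hYX, Matrix.mul_assoc Wᵀ]
        _ = Wᵀ * Y * (Xᵀ * W) := by simp only [Matrix.mul_assoc]
        _ = Wᵀ * Y := by rw [hXW', mul_one]
    · rw [fromBlocks_multiply]
      simp [← Matrix.mul_assoc, hXW]

/-- The parabolic subgroup as a subgroup of the group of units of the matrix ring. -/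
def parabolicSubgroup (F : Type*) [Field F] [CharP F 2] (n : ℕ) :
    Subgroup (Matrix (Fin n ⊕ Fin n) (Fin n ⊕ Fin n) F)ˣ where
  carrier := {u | (u : Matrix (Fin n ⊕ Fin n) (Fin n ⊕ Fin n) F) ∈ parabolic F n}
  one_mem' := one_mem_parabolic
  mul_mem' {u v} hu hv := by
    change _ ∈ parabolic F n at hu hv
    change _ ∈ parabolic F n
    rw [mem_parabolic_iff] at hu hv ⊢
    refine ⟨mul_mem hu.1 hv.1, ?_⟩
    rw [Units.val_mul, ← fromBlocks_toBlocks u.val, ← fromBlocks_toBlocks v.val, hu.2, hv.2,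
      fromBlocks_multiply, toBlocks_fromBlocks₂₁]
    simp
  inv_mem' {u} hu := by
    change _ ∈ parabolic F n at hu
    change _ ∈ parabolic F n
    obtain ⟨A, B, hB, h⟩ := hu
    have hAi : ((A⁻¹ : GL (Fin n) F) : Matrix (Fin n) (Fin n) F)ᵀ *
        (A : Matrix (Fin n) (Fin n) F)ᵀ = 1 := by
      rw [← transpose_mul, A.mul_inv, transpose_one]
    rw [coe_units_inv] at hAi
    have hinv : (u⁻¹ : (Matrix (Fin n ⊕ Fin n) (Fin n ⊕ Fin n) F)ˣ).val =
        fromBlocks ((A⁻¹ : GL (Fin n) F) : Matrix (Fin n) (Fin n) F)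
          (-B * (A : Matrix (Fin n) (Fin n) F)ᵀ) 0 (A : Matrix (Fin n) (Fin n) F)ᵀ := by
      refine Units.inv_eq_of_mul_eq_one_right ?_
      rw [h, fromBlocks_multiply, fromBlocks_multiply, ← fromBlocks_one]
      congr 1 <;> simp [hAi, Matrix.mul_assoc]
    refine ⟨A⁻¹, -(A * B * (A : Matrix (Fin n) (Fin n) F)ᵀ), ?_, ?_⟩
    · simp [transpose_mul, hB, Matrix.mul_assoc]
    · rw [hinv, fromBlocks_multiply, inv_inv, mul_neg]
      simp [← Matrix.mul_assoc]

theorem mem_parabolicSubgroup [CharP F 2] {u : (Matrix (Fin n ⊕ Fin n) (Fin n ⊕ Fin n) F)ˣ} :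
    u ∈ parabolicSubgroup F n ↔ (u : Matrix (Fin n ⊕ Fin n) (Fin n ⊕ Fin n) F) ∈ parabolic F n :=
  Iff.rfl

/-- The element of the parabolic subgroup with parameters `A` and `B`. -/
def parabolicElement (A : GL (Fin n) F) (B : Matrix (Fin n) (Fin n) F) :
    Matrix (Fin n ⊕ Fin n) (Fin n ⊕ Fin n) F :=
  fromBlocks A (A * B) 0 ((A⁻¹ : GL (Fin n) F) : Matrix (Fin n) (Fin n) F)ᵀ

theorem parabolicElement_eq (A : GL (Fin n) F) (B : Matrix (Fin n) (Fin n) F) :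
    fromBlocks (A : Matrix (Fin n) (Fin n) F) 0 0
          ((A⁻¹ : GL (Fin n) F) : Matrix (Fin n) (Fin n) F)ᵀ *
        fromBlocks 1 B 0 1 = parabolicElement A B := by
  rw [fromBlocks_multiply, parabolicElement]
  simp

theorem isUnit_of_mem_parabolic [CharP F 2] {w : Matrix (Fin n ⊕ Fin n) (Fin n ⊕ Fin n) F}
    (hw : w ∈ parabolic F n) : IsUnit w := by
  rw [isUnit_iff_isUnit_det]
  exact SymplecticGroup.symplectic_det (parabolic_subset_symplecticGroup hw)

/-- Parametrization of the parabolic subgroup. -/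
def parabolicEquiv (F : Type*) [Field F] [CharP F 2] (n : ℕ) :
    GL (Fin n) F × symmetricMatrices F (Fin n) ≃ parabolicSubgroup F n :=
  Equiv.ofBijective (fun p => ⟨(isUnit_of_mem_parabolic (F := F) (w := parabolicElement p.1 p.2.1)
    ⟨p.1, p.2.1, p.2.2, (parabolicElement_eq _ _).symm⟩).unit,
      ⟨p.1, p.2.1, p.2.2, (parabolicElement_eq _ _).symm⟩⟩) <| by
    constructor
    · rintro ⟨A, B, hB⟩ ⟨A', B', hB'⟩ h
      have h1 : parabolicElement A B = parabolicElement A' B' :=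
        congrArg Units.val (congrArg Subtype.val h)
      rw [parabolicElement, parabolicElement, fromBlocks_inj] at h1
      have hA := Units.ext h1.1
      subst hA
      have hB := A.isUnit.mul_left_cancel h1.2.1
      subst hB
      rfl
    · rintro ⟨u, A, B, hB, hu⟩
      refine ⟨⟨A, B, hB⟩, Subtype.ext (Units.ext ?_)⟩
      rw [hu, parabolicElement_eq]
      rfl

theorem parabolicEquiv_val [CharP F 2] (p : GL (Fin n) F × symmetricMatrices F (Fin n)) :
    ((parabolicEquiv F n p : (Matrix (Fin n ⊕ Fin n) (Fin n ⊕ Fin n) F)ˣ) :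
      Matrix (Fin n ⊕ Fin n) (Fin n ⊕ Fin n) F) = parabolicElement p.1 p.2 := rfl

/-- The condition is stable under powers, and over a finite field A⁻¹ is a power of A. -/
theorem mul_mul_eq_zero_inv [Finite F] {E : Matrix (Fin n) (Fin n) F} (hE : E * E = E)
    (A : GL (Fin n) F) (h : E * (A : Matrix (Fin n) (Fin n) F) * (1 - E) = 0) :
    E * ((A⁻¹ : GL (Fin n) F) : Matrix (Fin n) (Fin n) F) * (1 - E) = 0 := by
  have hpow : ∀ j : ℕ, E * ((A ^ j : GL (Fin n) F) : Matrix (Fin n) (Fin n) F) * (1 - E) = 0 := by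
    intro j
    induction j with
    | zero => simp [mul_sub, hE]
    | succ j ih =>
      rw [mul_sub, mul_one, sub_eq_zero] at ih
      rw [pow_succ, Units.val_mul, ← Matrix.mul_assoc, ih, Matrix.mul_assoc _ E, Matrix.mul_assoc,
        h, mul_zero]
  have hA : A⁻¹ = A ^ (orderOf A - 1) := by
    rw [inv_eq_iff_mul_eq_one, ← pow_succ', Nat.sub_add_cancel (orderOf_pos A), pow_orderOf_eq_one]
  rw [hA]
  exact hpow _

/-- Membership amounts to the vanishing of EA(1-E) + EABE + (EA⁻¹(1-E))ᵀ, the lower left block of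
the conjugate. -/
theorem sigma_conj_mem_iff [CharP F 2] [Finite F] (r : ℕ) (A : GL (Fin n) F)
    {B : Matrix (Fin n) (Fin n) F} (hB : Bᵀ = B) :
    sigma F n r * parabolicElement A B * sigma F n r ∈ parabolic F n ↔
      firstOnes F n r * (A : Matrix (Fin n) (Fin n) F) * (1 - firstOnes F n r) = 0 ∧
        firstOnes F n r * B * firstOnes F n r = 0 := by
  have hs := sigma_mem_symplecticGroup (F := F) (n := n) r
  have hp : parabolicElement A B ∈ symplecticGroup (Fin n) F :=
    parabolic_subset_symplecticGroup ⟨A, B, hB, (parabolicElement_eq _ _).symm⟩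
  rw [mem_parabolic_iff, and_iff_right (mul_mem (mul_mem hs hp) hs)]
  have hE := firstOnes_mul_self (F := F) n r
  have hEt := transpose_firstOnes (F := F) n r
  rw [sigma, parabolicElement, fromBlocks_multiply, fromBlocks_multiply, toBlocks_fromBlocks₂₁]
  generalize firstOnes F n r = E at *
  have hE' : E * (1 - E) = 0 := by rw [mul_sub, hE, mul_one, sub_self]
  have hE'' : (1 - E) * E = 0 := by rw [sub_mul, hE, one_mul, sub_self]
  have hA1 := A.inv_mul
  have htr : (1 - E) * ((A⁻¹ : GL (Fin n) F) : Matrix (Fin n) (Fin n) F)ᵀ * E =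
      (E * ((A⁻¹ : GL (Fin n) F) : Matrix (Fin n) (Fin n) F) * (1 - E))ᵀ := by
    rw [transpose_mul, transpose_mul, transpose_sub, transpose_one, hEt, Matrix.mul_assoc]
  have hform : (E * (A : Matrix (Fin n) (Fin n) F) + (1 - E) * 0) * (1 - E) +
      (E * ((A : Matrix (Fin n) (Fin n) F) * B) +
        (1 - E) * ((A⁻¹ : GL (Fin n) F) : Matrix (Fin n) (Fin n) F)ᵀ) * E =
      E * A.val * (1 - E) + E * A.val * B * E +
        (E * ((A⁻¹ : GL (Fin n) F) : Matrix (Fin n) (Fin n) F) * (1 - E))ᵀ := by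
    rw [← htr, mul_zero, add_zero, add_mul, ← Matrix.mul_assoc, add_assoc]
  rw [hform]
  generalize hA' : ((A⁻¹ : GL (Fin n) F) : Matrix (Fin n) (Fin n) F) = A' at *
  have hinv := fun h => hA' ▸ mul_mul_eq_zero_inv (E := E) hE A h
  constructor
  · intro h
    have h1 : E * A.val * (1 - E) = 0 := by
      -- Multiplying by E and 1 - E isolates the first term, because the other two end in E.
      have h2 := congrArg (fun M => E * M * (1 - E)) h
      simp only [mul_add, add_mul, mul_zero, zero_mul, ← htr] at h2
      rw [Matrix.mul_assoc E (E * A.val * B * E), Matrix.mul_assoc (E * A.val * B) E, hE', mul_zero,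
        mul_zero, add_zero, Matrix.mul_assoc E (_ * E) (1 - E), Matrix.mul_assoc _ E, hE', mul_zero,
        mul_zero, add_zero, ← Matrix.mul_assoc, ← Matrix.mul_assoc, hE, Matrix.mul_assoc _ (1 - E),
        mul_sub (1 - E), hE'', mul_one, sub_zero] at h2
      exact h2
    refine ⟨h1, ?_⟩
    rw [h1, hinv h1, transpose_zero, zero_add, add_zero] at h
    have h3 : E * A.val = E * A.val * E := by
      rwa [mul_sub, mul_one, sub_eq_zero] at h1
    have h4 : E * A' = E * A' * E := by
      have := hinv h1
      rwa [mul_sub, mul_one, sub_eq_zero] at this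
    calc E * B * E = E * (A' * A.val) * B * E := by rw [hA1, mul_one]
      _ = (E * A') * A.val * B * E := by simp only [Matrix.mul_assoc]
      _ = (E * A' * E) * A.val * B * E := by rw [← h4]
      _ = E * A' * (E * A.val * B * E) := by simp only [Matrix.mul_assoc]
      _ = 0 := by rw [h, mul_zero]
  · rintro ⟨h1, h2⟩
    rw [h1, hinv h1, transpose_zero, zero_add, add_zero]
    have h3 : E * A.val = E * A.val * E := by
      rwa [mul_sub, mul_one, sub_eq_zero] at h1
    rw [h3, Matrix.mul_assoc (E * A.val), Matrix.mul_assoc (E * A.val), h2, mul_zero]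

end Parabolic

/-! ### Orthogonality over symmetric matrices and the weight identity. -/

section Weights

variable {F : Type*} [Field F]

theorem trace_mul_eq_zero_of_isAlternating {n : ℕ} {M B : Matrix (Fin n) (Fin n) F}
    (hM : IsAlternating M) (hB : Bᵀ = B) : (M * B).trace = 0 := by
  have h1 : ∀ i j, M j i = - M i j := fun i j => congrFun (congrFun hM.1 i) j
  have h2 : ∀ i j, B j i = B i j := fun i j => congrFun (congrFun hB i) j
  simp only [trace, diag, mul_apply]
  rw [← Finset.sum_product']
  refine Finset.sum_involution (fun p _ => p.swap) ?_ ?_ ?_ ?_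
  · rintro ⟨i, j⟩ _
    simp only [Prod.swap]
    rw [h1 i j, h2 i j]
    ring
  · rintro ⟨i, j⟩ _ h
    simp only [Prod.swap, ne_eq, Prod.mk.injEq, not_and]
    rintro rfl
    simp [hM.2] at h
  · simp
  · simp

/-- The test matrices e_ij + e_ji give skew symmetry; e_ii gives the zero diagonal, which is a
separate condition in characteristic two. -/
theorem isAlternating_of_trace_mul {n : ℕ} {M : Matrix (Fin n) (Fin n) F}
    (h : ∀ B : Matrix (Fin n) (Fin n) F, Bᵀ = B → (M * B).trace = 0) : IsAlternating M := by
  refine ⟨?_, fun i => ?_⟩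
  · ext i j
    have := h (single i j 1 + single j i 1) (by simp [add_comm])
    rw [Matrix.mul_add, trace_add, trace_mul_single, trace_mul_single] at this
    simp at this
    rw [transpose_apply, Matrix.neg_apply]
    linear_combination this
  · have := h (single i i 1) (by simp)
    rw [trace_mul_single] at this
    simpa using this

theorem trace_parabolicElement_mul_sigma {n : ℕ} (r : ℕ) (A : GL (Fin n) F)
    (B : Matrix (Fin n) (Fin n) F) :
    (parabolicElement A B * sigma F n r).trace =
      (firstOnes F n r * A.val * B).trace + ((A.val * (1 - firstOnes F n r)).trace +
        (A⁻¹.val * (1 - firstOnes F n r)).trace) := by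
  rw [parabolicElement, sigma, fromBlocks_multiply, trace_fromBlocks_eq, trace_add, zero_mul,
    zero_add, ← trace_transpose (A⁻¹.valᵀ * _), transpose_mul, transpose_transpose, transpose_sub,
    transpose_one, transpose_firstOnes, trace_mul_comm (1 - firstOnes F n r),
    trace_mul_comm (A.val * B), ← Matrix.mul_assoc]
  ring

theorem card_parabolicSubgroup [CharP F 2] (n : ℕ) : Nat.card (parabolicSubgroup F n) =
    Nat.card (GL (Fin n) F) * Nat.card (symmetricMatrices F (Fin n)) := by
  rw [← Nat.card_congr (parabolicEquiv F n), Nat.card_prod]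

theorem codeword_mem_dualCode [Algebra (ZMod 2) F] {ι : Type*} [Fintype ι] {S : Set (Matrix ι ι F)} {N : ℕ}
    (g : Fin N ≃ S) (a : F) : codeword g a ∈ dualCode (code (traceVector g)) := by
  intro u hu
  have hu' : ∑ j, algebraMap (ZMod 2) F (u j) * traceVector g j = 0 := hu
  have h : u ⬝ᵥ codeword g a =
      tr (a * ∑ j, algebraMap (ZMod 2) F (u j) * traceVector g j) := by
    simp only [tr, Finset.mul_sum, map_sum, dotProduct, codeword]
    refine Finset.sum_congr rfl fun j _ => ?_
    rw [mul_left_comm, ← Algebra.smul_def, map_smul, smul_eq_mul]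
  rw [h, hu', mul_zero, tr, map_zero]

/-- The conditions on A and B are independent, so the intersection is a product set. The factor
|Sym_r| on the left avoids a division. -/
theorem card_parabolic_inter [Fintype F] [CharP F 2] (r k : ℕ)
    (s : (Matrix (Fin (r + k) ⊕ Fin (r + k)) (Fin (r + k) ⊕ Fin (r + k)) F)ˣ)
    (hs : s.val = sigma F (r + k) r) :
    Nat.card {p : parabolicSubgroup F (r + k) // s⁻¹ * p * s ∈ parabolicSubgroup F (r + k)} *
      Nat.card (symmetricMatrices F (Fin r)) =
    (Nat.card (GL (Fin r) F) * (Nat.card (GL (Fin k) F) * Fintype.card F ^ (k * r))) *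
      Nat.card (symmetricMatrices F (Fin (r + k))) := by
  have hs' : s⁻¹ = s := by
    rw [inv_eq_iff_mul_eq_one]
    refine Units.ext ?_
    rw [Units.val_mul, hs, sigma_mul_self, Units.val_one]
  have e := ((parabolicEquiv F (r + k)).subtypeEquiv (q := fun p : parabolicSubgroup F (r + k) =>
    s⁻¹ * p * s ∈ parabolicSubgroup F (r + k)) (p := fun p =>
      firstOnes F (r + k) r * p.1.val * (1 - firstOnes F (r + k) r) = 0 ∧
        firstOnes F (r + k) r * p.2.1 * firstOnes F (r + k) r = 0) fun p => by
      rw [mem_parabolicSubgroup, hs', Units.val_mul, Units.val_mul, hs, parabolicEquiv_val,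
        sigma_conj_mem_iff r p.1 p.2.2]).symm.trans (Equiv.subtypeProdEquivProd
      (p := fun A : GL (Fin (r + k)) F =>
        firstOnes F (r + k) r * A.val * (1 - firstOnes F (r + k) r) = 0)
      (q := fun B : symmetricMatrices F (Fin (r + k)) =>
        firstOnes F (r + k) r * B.1 * firstOnes F (r + k) r = 0))
  rw [Nat.card_congr e, Nat.card_prod, card_lower, mul_assoc, card_symmetric_firstOnes]

variable [Fintype F] [Algebra (ZMod 2) F]

-- The summand is an additive character of the group of symmetric matrices, trivial exactly when M
-- is alternating.
open scoped Classical in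
theorem sum_symmetric_canonicalChar {n : ℕ} {a : F} (ha : a ≠ 0) (M : Matrix (Fin n) (Fin n) F) :
    ∑ B : symmetricMatrices F (Fin n), canonicalChar F (a * (M * B.1).trace) =
      if IsAlternating M then (Nat.card (symmetricMatrices F (Fin n)) : ℂ) else 0 := by
  split_ifs with hM
  · rw [Finset.sum_congr rfl fun B _ => by rw [trace_mul_eq_zero_of_isAlternating hM B.2]]
    simp [Nat.card_eq_fintype_card]
  · let ψ : AddChar (symmetricMatrices F (Fin n)) ℂ :=
      { toFun := fun B => canonicalChar F (a * (M * B.1).trace)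
        map_zero_eq_one' := by simp
        map_add_eq_mul' := fun B C => by
          rw [← AddChar.map_add_eq_mul, ← mul_add, ← trace_add, ← mul_add]
          rfl }
    change ∑ B, ψ B = 0
    rw [AddChar.sum_eq_zero_iff_ne_zero]
    intro h0
    refine hM (isAlternating_of_trace_mul fun B hB => ?_)
    by_contra ht
    refine canonicalChar_ne_zero (F := F) (DFunLike.ext _ _ fun x => ?_)
    -- Rescaling one B with Tr(MB) ≠ 0 makes a Tr(MB) equal to any prescribed x, so triviality here
    -- would make λ trivial.
    have h := DFunLike.congr_fun h0 ⟨(x * a⁻¹ * (M * B).trace⁻¹) • B, by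
      rw [mem_symmetricMatrices, transpose_smul, hB]⟩
    change canonicalChar F (a * (M * ((x * a⁻¹ * (M * B).trace⁻¹) • B)).trace) = 1 at h
    rw [mul_smul_comm, trace_smul, smul_eq_mul] at h
    rw [AddChar.zero_apply, ← h]
    congr 1
    field_simp

open scoped Classical in
theorem sum_parabolic [DecidableEq F] [CharP F 2] (r k : ℕ) {a : F} (ha : a ≠ 0) :
    ∑ w : parabolicSubgroup F (r + k), canonicalChar F (a * (w.1.val * sigma F (r + k) r).trace) =
      Nat.card (symmetricMatrices F (Fin (r + k))) *
        (altCount F (Fin r) * ((Fintype.card F : ℂ) ^ (k * r) * glKloosterman k a)) := by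
  rw [← Equiv.sum_comp (parabolicEquiv F (r + k)), Fintype.sum_prod_type,
    ← sum_isAlternating_firstOnes_mul, Finset.mul_sum]
  refine Fintype.sum_congr _ _ fun A => ?_
  have hadd : ∀ x y : F, canonicalChar F (a * (x + y)) =
      canonicalChar F (a * x) * canonicalChar F (a * y) := fun x y => by
    rw [mul_add, AddChar.map_add_eq_mul]
  simp only [parabolicEquiv_val, trace_parabolicElement_mul_sigma]
  rw [Fintype.sum_congr _ _ fun B => hadd _ _, ← Finset.sum_mul, sum_symmetric_canonicalChar ha]
  split_ifs <;> simp

theorem two_mul_hammingNorm_codeword {ι : Type*} [Fintype ι] {S : Set (Matrix ι ι F)} [Fintype S]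
    {N : ℕ} (g : Fin N ≃ S) (a : F) : 2 * (hammingNorm (codeword g a) : ℂ) =
      Fintype.card S - ∑ x : S, canonicalChar F (a * x.1.trace) := by
  have h : ∀ c : ZMod 2, (2 : ℂ) * (if c ≠ 0 then 1 else 0) = 1 - (-1) ^ c.val := by
    intro c
    obtain rfl | rfl : c = 0 ∨ c = 1 := by revert c; decide
    · simp
    · norm_num [ZMod.val_one]
  have h2 : (hammingNorm (codeword g a) : ℂ) =
      ∑ j, if codeword g a j ≠ 0 then (1 : ℂ) else 0 := by
    rw [Finset.sum_boole, hammingNorm]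
  rw [h2, Finset.mul_sum, Finset.sum_congr rfl fun j _ => h _, Finset.sum_sub_distrib,
    ← Equiv.sum_comp g, ← Fintype.card_congr g]
  simp
  rfl

theorem hammingNorm_codeword_mul [DecidableEq F] (r k : ℕ) {a : F} (ha : a ≠ 0) {N : ℕ}
    (g : Fin N ≃ PsigmaP F (r + k) r) :
    2 * (hammingNorm (codeword g a) : ℂ) * (Nat.card (GL (Fin r) F) * (Nat.card (GL (Fin k) F) *
      (Fintype.card F : ℂ) ^ (k * r))) =
    Nat.card (symmetricMatrices F (Fin r)) * Nat.card (GL (Fin (r + k)) F) *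
      Nat.card (symmetricMatrices F (Fin (r + k))) * (Nat.card (GL (Fin (r + k)) F) -
        altCount F (Fin r) * ((Fintype.card F : ℂ) ^ (k * r) * glKloosterman k a)) := by
  classical
  have := charP_two_of_algebra F
  let s : (Matrix (Fin (r + k) ⊕ Fin (r + k)) (Fin (r + k) ⊕ Fin (r + k)) F)ˣ :=
    ⟨sigma F (r + k) r, sigma F (r + k) r, sigma_mul_self r, sigma_mul_self r⟩
  have hD : PsigmaP F (r + k) r = DoubleCoset.doubleCoset s.val
      ((fun u : (Matrix (Fin (r + k) ⊕ Fin (r + k)) (Fin (r + k) ⊕ Fin (r + k)) F)ˣ => u.val) ''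
        parabolicSubgroup F (r + k))
      ((fun u : (Matrix (Fin (r + k) ⊕ Fin (r + k)) (Fin (r + k) ⊕ Fin (r + k)) F)ˣ => u.val) ''
        parabolicSubgroup F (r + k)) := by
    have hP : ((fun u : (Matrix (Fin (r + k) ⊕ Fin (r + k)) (Fin (r + k) ⊕ Fin (r + k)) F)ˣ =>
        u.val) '' parabolicSubgroup F (r + k)) = parabolic F (r + k) := by
      ext w
      constructor
      · rintro ⟨u, hu, rfl⟩
        exact hu
      · intro hw
        exact ⟨(isUnit_of_mem_parabolic hw).unit, hw, rfl⟩
    rw [hP]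
    rfl
  have h1 := card_mul_sum_doubleCoset (parabolicSubgroup F (r + k)) s _ hD
    (fun x => canonicalChar F (a * x.trace)) fun x y => by rw [trace_mul_comm]
  have h2 := card_mul_sum_doubleCoset (parabolicSubgroup F (r + k)) s _ hD
    (fun _ => 1) fun x y => rfl
  rw [sum_parabolic r k ha] at h1
  have hI := card_parabolic_inter r k s rfl
  rw [← Nat.card_eq_fintype_card, card_parabolicSubgroup] at h1 h2
  simp only [Finset.sum_const, Finset.card_univ, nsmul_eq_mul, mul_one] at h2
  rw [← Nat.card_eq_fintype_card (α := parabolicSubgroup F (r + k)), card_parabolicSubgroup] at h2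
  rw [two_mul_hammingNorm_codeword]
  have hI' := congrArg (Nat.cast : ℕ → ℂ) hI
  push_cast at hI' h1 h2
  have hs : (Nat.card (symmetricMatrices F (Fin (r + k))) : ℂ) ≠ 0 :=
    Nat.cast_ne_zero.2 Nat.card_pos.ne'
  refine mul_left_cancel₀ hs ?_
  -- After multiplication by |Sym_n|, `hI'` trades the group orders for |P ∩ σPσ⁻¹|·|Sym_r|, and `h2
  -- - h1` evaluates the result.
  linear_combination (-((Fintype.card (PsigmaP F (r + k) r) : ℂ) -
    ∑ x : PsigmaP F (r + k) r, canonicalChar F (a * x.1.trace))) * hI' +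
    (Nat.card (symmetricMatrices F (Fin r)) : ℂ) * (h2 - h1)

end Weights

/-! ### Group orders and the explicit constants. -/

section ClosedForms

variable {F : Type*} [Field F] [Fintype F]

theorem prod_range_pow_sub_pow (q : ℂ) (n : ℕ) : ∏ i ∈ Finset.range n, (q ^ n - q ^ i) =
    q ^ n.choose 2 * ∏ j ∈ Finset.Icc 1 n, (q ^ j - 1) := by
  induction n with
  | zero => simp
  | succ n ih =>
    have h2 : ∏ i ∈ Finset.range n, (q ^ (n + 1) - q ^ (i + 1)) =
        q ^ n * ∏ i ∈ Finset.range n, (q ^ n - q ^ i) := by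
      have h := Finset.pow_card_mul_prod (s := Finset.range n) (b := q)
        (f := fun i => q ^ n - q ^ i)
      rw [Finset.card_range] at h
      rw [h]
      exact Finset.prod_congr rfl fun i _ => by ring
    rw [Finset.prod_range_succ', h2, ih, Finset.prod_Icc_succ_top (by omega),
      Nat.choose_succ_succ' n 1, Nat.choose_one_right, pow_zero, pow_add]
    ring

theorem card_GL_eq (n : ℕ) : (Nat.card (GL (Fin n) F) : ℂ) =
    (Fintype.card F : ℂ) ^ n.choose 2 *
      ∏ j ∈ Finset.Icc 1 n, ((Fintype.card F : ℂ) ^ j - 1) := by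
  rw [card_GL_field, Nat.cast_prod, ← prod_range_pow_sub_pow, ← Fin.prod_univ_eq_prod_range
    (fun i => (Fintype.card F : ℂ) ^ n - (Fintype.card F : ℂ) ^ i)]
  refine Finset.prod_congr rfl fun i _ => ?_
  rw [Nat.cast_sub (Nat.pow_le_pow_right Fintype.card_pos i.2.le)]
  simp

/-- Up to a power of q, the odd part counts the nonsingular alternating matrices of size 2m. It
factors out of the weight into A, leaving the even part in B. -/
theorem prod_Icc_two_mul (q : ℂ) (m : ℕ) : ∏ j ∈ Finset.Icc 1 (2 * m), (q ^ j - 1) =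
    (∏ j ∈ Finset.Icc 1 m, (q ^ (2 * j - 1) - 1)) * ∏ j ∈ Finset.Icc 1 m, (q ^ (2 * j) - 1) := by
  induction m with
  | zero => simp
  | succ m ih =>
    rw [show 2 * (m + 1) = 2 * m + 1 + 1 by ring, Finset.prod_Icc_succ_top (by omega),
      Finset.prod_Icc_succ_top (by omega), ih, Finset.prod_Icc_succ_top (by omega),
      Finset.prod_Icc_succ_top (by omega), show 2 * (m + 1) - 1 = 2 * m + 1 by omega,
      show 2 * (m + 1) = 2 * m + 1 + 1 by ring]
    ring

theorem card_cast_pow_sub_one_ne_zero {j : ℕ} (hj : j ≠ 0) :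
    (Fintype.card F : ℂ) ^ j - 1 ≠ 0 := by
  rw [sub_ne_zero]
  exact_mod_cast (Nat.one_lt_pow hj Fintype.one_lt_card).ne'

theorem choose_two_two_mul (m : ℕ) : (2 * m).choose 2 = 2 * (m * (m - 1)) + m := by
  rw [Nat.choose_two_right]
  rcases m with _ | m
  · rfl
  · rw [show 2 * (m + 1) * (2 * (m + 1) - 1) = 2 * ((m + 1) * (2 * m + 1)) by
      rw [show 2 * (m + 1) - 1 = 2 * m + 1 by omega]; ring, Nat.mul_div_cancel_left _ two_pos]
    simp
    ring

variable [DecidableEq F] [Algebra (ZMod 2) F]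

theorem hammingNorm_codeword_minus (m : ℕ) {a : F} (ha : a ≠ 0) {N : ℕ}
    (g : Fin N ≃ DCminus F (2 * m + 1)) : (hammingNorm (codeword g a) : ℂ) =
      1 / 2 * Aminus (2 * m + 1) (Fintype.card F) * (Bminus (2 * m + 1) (Fintype.card F) -
        kloosterman 1 (canonicalChar F) a) := by
  have h := hammingNorm_codeword_mul (2 * m) 1 ha (N := N) g
  set w : ℂ := (hammingNorm (codeword g a) : ℂ)
  have hw : (hammingNorm (codeword (S := PsigmaP F (2 * m + 1) (2 * m)) g a) : ℂ) = w := rfl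
  rw [hw] at h
  clear_value w
  rw [glKloosterman_one a ha, altCount_two_mul, card_symmetricMatrices, card_symmetricMatrices,
    card_GL_eq, card_GL_eq, card_GL_eq, Finset.prod_Icc_succ_top (b := 2 * m) (by omega),
    prod_Icc_two_mul, Nat.choose_succ_succ' (2 * m + 1), Nat.choose_succ_succ' (2 * m),
    choose_two_two_mul] at h
  rw [Aminus, Bminus, qBinom]
  have hq : (Fintype.card F : ℂ) ≠ 0 := Nat.cast_ne_zero.2 Fintype.card_ne_zero
  have hO : ∏ j ∈ Finset.Icc 1 m, ((Fintype.card F : ℂ) ^ (2 * j - 1) - 1) ≠ 0 :=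
    Finset.prod_ne_zero_iff.2 fun j hj => card_cast_pow_sub_one_ne_zero (by
      have := (Finset.mem_Icc.1 hj).1; omega)
  have hE : ∏ j ∈ Finset.Icc 1 m, ((Fintype.card F : ℂ) ^ (2 * j) - 1) ≠ 0 :=
    Finset.prod_ne_zero_iff.2 fun j hj => card_cast_pow_sub_one_ne_zero (by
      have := (Finset.mem_Icc.1 hj).1; omega)
  have h1 : (Fintype.card F : ℂ) - 1 ≠ 0 := by
    simpa using card_cast_pow_sub_one_ne_zero (F := F) one_ne_zero
  -- With d = m(m-1) as an atom, all exponents become linear in d and m, and the divisions by 4 are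
  -- exact.
  have hm : m ^ 2 = m * (m - 1) + m := by
    rcases m with _ | m
    · rfl
    · simp; ring
  have e1 : (5 * (2 * m + 1) ^ 2 - 1) / 4 = 5 * (m * (m - 1)) + 10 * m + 1 := by
    rw [show 5 * (2 * m + 1) ^ 2 = 20 * m ^ 2 + 20 * m + 5 by ring, hm]
    omega
  have e2 : (2 * m + 1 - 1) ^ 2 / 4 = m * (m - 1) + m := by
    rw [← hm, Nat.add_sub_cancel, mul_pow]
    omega
  have e3 : (2 * m + 1 - 1) / 2 = m := by omega
  rw [e1, e2, e3]
  simp only [Finset.prod_range_one, Nat.sub_zero, Finset.Icc_self, Finset.prod_singleton,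
    Nat.choose_one_right, Nat.cast_pow, one_mul, pow_one] at h ⊢
  generalize (Fintype.card F : ℂ) ^ (2 * m + 1) - 1 = u at *
  generalize ∏ j ∈ Finset.Icc 1 m, ((Fintype.card F : ℂ) ^ (2 * j - 1) - 1) = O at *
  generalize ∏ j ∈ Finset.Icc 1 m, ((Fintype.card F : ℂ) ^ (2 * j) - 1) = E at *
  generalize kloosterman 1 (canonicalChar F) a = K at *
  generalize m * (m - 1) = d at *
  rw [show Nat.choose 1 2 = 0 from rfl] at h
  generalize (Fintype.card F : ℂ) = q at *
  -- This is |GL(2m)|·|GL(1)|·q^(2m), the factor multiplying the weight in `h`.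
  have hC : q ^ (2 * d + m) * (O * E) * (q ^ 0 * (q - 1) * q ^ (2 * m)) ≠ 0 := by
    simp [hq, hO, hE, h1]
  refine mul_right_cancel₀ hC (mul_left_cancel₀ two_ne_zero ?_)
  rw [← mul_assoc, h]
  field_simp
  ring

theorem hammingNorm_codeword_plus (m : ℕ) {a : F} (ha : a ≠ 0) {N : ℕ}
    (g : Fin N ≃ DCplus F (2 * m + 2)) : (hammingNorm (codeword g a) : ℂ) =
      1 / 2 * Aplus (2 * m + 2) (Fintype.card F) * (Bplus (2 * m + 2) (Fintype.card F) -
        (Fintype.card F : ℂ) ^ 2 + Fintype.card F - kloosterman 1 (canonicalChar F) a ^ 2) := by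
  have h := hammingNorm_codeword_mul (2 * m) 2 ha (N := N) g
  set w : ℂ := (hammingNorm (codeword g a) : ℂ)
  have hw : (hammingNorm (codeword (S := PsigmaP F (2 * m + 2) (2 * m)) g a) : ℂ) = w := rfl
  rw [hw] at h
  clear_value w
  rw [glKloosterman_two a ha, altCount_two_mul, card_symmetricMatrices, card_symmetricMatrices,
    card_GL_eq, card_GL_eq, card_GL_eq, Finset.prod_Icc_succ_top (b := 2 * m + 1) (by omega),
    Finset.prod_Icc_succ_top (b := 2 * m) (by omega),
    prod_Icc_two_mul, Nat.choose_succ_succ' (2 * m + 2), Nat.choose_succ_succ' (2 * m + 1),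
    Nat.choose_succ_succ' (2 * m), choose_two_two_mul] at h
  rw [Aplus, Bplus, qBinom]
  have hq : (Fintype.card F : ℂ) ≠ 0 := Nat.cast_ne_zero.2 Fintype.card_ne_zero
  have hO : ∏ j ∈ Finset.Icc 1 m, ((Fintype.card F : ℂ) ^ (2 * j - 1) - 1) ≠ 0 :=
    Finset.prod_ne_zero_iff.2 fun j hj => card_cast_pow_sub_one_ne_zero (by
      have := (Finset.mem_Icc.1 hj).1; omega)
  have hE : ∏ j ∈ Finset.Icc 1 m, ((Fintype.card F : ℂ) ^ (2 * j) - 1) ≠ 0 :=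
    Finset.prod_ne_zero_iff.2 fun j hj => card_cast_pow_sub_one_ne_zero (by
      have := (Finset.mem_Icc.1 hj).1; omega)
  have h1 : (Fintype.card F : ℂ) - 1 ≠ 0 := by
    simpa using card_cast_pow_sub_one_ne_zero (F := F) one_ne_zero
  have h2 : (Fintype.card F : ℂ) ^ 2 - 1 ≠ 0 := card_cast_pow_sub_one_ne_zero two_ne_zero
  have hm : m ^ 2 = m * (m - 1) + m := by
    rcases m with _ | m
    · rfl
    · simp; ring
  have e1 : (5 * (2 * m + 2) ^ 2 - 2 * (2 * m + 2)) / 4 = 5 * (m * (m - 1)) + 14 * m + 4 := by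
    rw [show 5 * (2 * m + 2) ^ 2 = 20 * m ^ 2 + 40 * m + 20 by ring, hm]
    omega
  have e2 : (2 * m + 2 - 2) ^ 2 / 4 = m * (m - 1) + m := by
    rw [← hm, Nat.add_sub_cancel, mul_pow]
    omega
  have e3 : (2 * m + 2 - 2) / 2 = m := by omega
  have e4 : 2 * m + 2 - 1 = 2 * m + 1 := by omega
  have e5 : ∏ j ∈ Finset.Icc 1 2, ((Fintype.card F : ℂ) ^ j - 1) =
      (Fintype.card F - 1) * ((Fintype.card F : ℂ) ^ 2 - 1) := by
    rw [Finset.prod_Icc_succ_top (by omega)]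
    simp
  rw [e1, e2, e3, Finset.prod_range_succ, Finset.prod_range_one, e4]
  rw [e5] at h
  simp only [Nat.sub_zero, show 2 - 1 = 1 from rfl,
    Nat.choose_one_right, Nat.cast_pow, pow_one, Nat.choose_self] at h ⊢
  rw [show 2 * m + 1 + 1 = 2 * m + 2 from rfl] at h
  generalize (Fintype.card F : ℂ) ^ (2 * m + 1) - 1 = u at *
  generalize (Fintype.card F : ℂ) ^ (2 * m + 2) - 1 = v at *
  generalize ∏ j ∈ Finset.Icc 1 m, ((Fintype.card F : ℂ) ^ (2 * j - 1) - 1) = O at *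
  generalize ∏ j ∈ Finset.Icc 1 m, ((Fintype.card F : ℂ) ^ (2 * j) - 1) = E at *
  generalize kloosterman 1 (canonicalChar F) a = K at *
  generalize m * (m - 1) = d at *
  generalize (Fintype.card F : ℂ) = q at *
  -- As in the odd case, now with |GL(2)| = q(q-1)(q²-1) and q^(4m).
  have hC : q ^ (2 * d + m) * (O * E) * (q * ((q - 1) * (q ^ 2 - 1)) * q ^ (2 * (2 * m))) ≠ 0 := by
    simp [hq, hO, hE, h1, h2]
  refine mul_right_cancel₀ hC (mul_left_cancel₀ two_ne_zero ?_)
  rw [← mul_assoc, h]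
  field_simp
  ring

end ClosedForms

end SpCodes

end

/-! ### The two weight formulas. -/

theorem lemma15 {F : Type*} [Field F] [Fintype F] [DecidableEq F] [Algebra (ZMod 2) F] :
    (∀ n : ℕ, Odd n →
      ∀ g : Fin (Nat.card (SpCodes.DCminus F n)) ≃ SpCodes.DCminus F n,
      ∀ a : F, a ≠ 0 →
        SpCodes.codeword g a ∈ SpCodes.dualCode (SpCodes.code (SpCodes.traceVector g)) ∧
        (hammingNorm (SpCodes.codeword g a) : ℂ) =
          1 / 2 * SpCodes.Aminus n (Fintype.card F) *
            (SpCodes.Bminus n (Fintype.card F) -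
              SpCodes.kloosterman 1 (SpCodes.canonicalChar F) a)) ∧
    (∀ n : ℕ, Even n → 0 < n →
      ∀ g : Fin (Nat.card (SpCodes.DCplus F n)) ≃ SpCodes.DCplus F n,
      ∀ a : F, a ≠ 0 →
        SpCodes.codeword g a ∈ SpCodes.dualCode (SpCodes.code (SpCodes.traceVector g)) ∧
        (hammingNorm (SpCodes.codeword g a) : ℂ) =
          1 / 2 * SpCodes.Aplus n (Fintype.card F) *
            (SpCodes.Bplus n (Fintype.card F) - (Fintype.card F : ℂ) ^ 2 + (Fintype.card F : ℂ) -
              SpCodes.kloosterman 1 (SpCodes.canonicalChar F) a ^ 2) ∧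
        (hammingNorm (SpCodes.codeword g a) : ℂ) =
          1 / 2 * SpCodes.Aplus n (Fintype.card F) *
            (SpCodes.Bplus n (Fintype.card F) - (Fintype.card F : ℂ) ^ 2 -
              SpCodes.kloosterman 2 (SpCodes.canonicalChar F) a)) := by
  refine ⟨?_, ?_⟩
  · rintro n ⟨m, rfl⟩ g a ha
    exact ⟨SpCodes.codeword_mem_dualCode g a, SpCodes.hammingNorm_codeword_minus m ha g⟩
  · rintro n hn h0 g a ha
    -- Positivity excludes n = 0, where n - 2 would truncate; now r = 2m and k = 2.
    obtain ⟨m, rfl⟩ : ∃ m, n = 2 * m + 2 := by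
      obtain ⟨m, rfl⟩ := hn
      exact ⟨m - 1, by omega⟩
    have h := SpCodes.hammingNorm_codeword_plus m ha g
    refine ⟨SpCodes.codeword_mem_dualCode g a, h, ?_⟩
    rw [h, SpCodes.kloosterman_two_eq a ha]
    ring
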